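/- Let $R\ge 1$ be an integer and $\eta\in[0,1]$. Let $(U_m)_{m\ge0}$ be the Markov chain on $\{1,\dots,R\}$ with transition matrix $P=[p_{ij}]$, $p_{ij}=1/i$ if $R-i<j\le R$ and $p_{ij}=0$ otherwise, and let $\theta_1,\theta_2,\dots$ be real random variables such that, given $U_0,\dots,U_m,\theta_1,\dots,\theta_m$, the variables $U_{m+1}$ and $\theta_{m+1}$ are independent, $U_{m+1}=j$ with probability $p_{U_m j}$, and $\theta_{m+1}$ is distributed as the minimum of $U_m$ independent uniform variables on $[\eta,1]$, i.e. $\mathbb P[\theta_{m+1}\le t\mid U_m=u]=1-\left(\frac{1-t}{1-\eta}\right)^u$ for $\eta\le t\le 1$, and it is $0$ for $t<\eta$ and $1$ for $t>1$ (for $\eta=1$, $\theta_{m+1}=1$). Let $$T_m=\sum_{i=1}^m\theta_i,\qquad H^{(n)}=\min\Big\{m:\sum_{i=1}^m U_i\ge n\Big\},\qquad T^{(n)}=T_{H^{(n)}}=\sum_{i=1}^{H^{(n)}}\theta_i .$$ Let $\boldsymbol\pi=\frac{2}{R(R+1)}(1,\dots,R)$ be the stationary distribution of the chain, $\mu_U=\sum_{j=1}^R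 j\pi_j$ and $\mu_\theta=\sum_{j=1}^R\pi_j\left(\eta+\frac{1-\eta}{j+1}\right)$. The initial distribution of $U_0$ is arbitrary in the limits of variances below (in particular $U_0=1$ and $U_0\sim\boldsymbol\pi$ are allowed, and the limits do not depend on it); all covariances, as well as $\mathrm{Var}[U_0]$ and $\mathrm{Var}[\theta_1]$, are taken for the stationary chain, $U_0\sim\boldsymbol\pi$. Then $$\lim_{n\to\infty}\frac{\mathrm{Var}[T^{(n)}]}{n}=\sigma_T^2=\frac{\gamma_T^2}{\mu_U^3}=\frac{\mu_\theta^2\gamma_U^2+\mu_U^2\gamma_\theta^2-2\mu_U\mu_\theta\Delta}{\mu_U^3},$$ where all limits and inverses below exist and all series below converge: $$\gamma_T^2=\lim_{m\to\infty}\frac1m\mathrm{Var}\Big[\Big(\sum_{i=0}^mU_i\Big)\mu_\theta-T_{m+1}\mu_U\Big],$$ $$\gamma_U^2=\lim_{m\to\infty}\frac1m\mathrm{Var}\Big[\sum_{i=0}^mU_i\Big]=\mathrm{Var}[U_0]+2\sum_{j=1}^\infty\mathrm{Cov}[U_0,U_j],$$ $$\gamma_\theta^2=\lim_{m\to\infty}\frac1m\mathrm{Var}[T_{m+1}]=\mathrm{Var}[\theta_1]+2\boldsymbol\pi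 MZM\mathbf 1-2\mu_\theta^2,$$ with $Z=(I-P+\mathbf 1\boldsymbol\pi)^{-1}$ and $M=\left[p_{ij}\left(\eta+\frac{1-\eta}{i+1}\right)\right]$, and $$\Delta=\mathrm{Cov}[\theta_1,U_0]+\sum_{j=1}^\infty\mathrm{Cov}[U_0,\theta_{j+1}]+\sum_{j=1}^\infty\mathrm{Cov}[\theta_1,U_j]=(1-\eta)\frac{(4R+8)\left(\sum_{j=1}^{R+1}\frac1j\right)-(R^2+9R+8)}{9R^2+9R}.$$ -/

import Mathlib

open MeasureTheory ProbabilityTheory Filter Topology Matrix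

noncomputable section

namespace Trickle

/-- The state space `{1, …, R}` of the chain of numbers of newly updated nodes. -/
abbrev State (R : ℕ) : Type := ↥(Finset.Icc 1 R)

/-- The transition matrix: `p i j = 1 / i` if `R - i < j ≤ R`, and `0` otherwise. -/
def transMatrix (R : ℕ) : Matrix (State R) (State R) ℝ :=
  Matrix.of fun i j => if (R : ℤ) - (i : ℕ) < (j : ℕ) ∧ (j : ℕ) ≤ R then 1 / ((i : ℕ) : ℝ) else 0

/-- The steady-state probability vector `π = 2 / (R (R + 1)) * (1, …, R)`. -/
def steady (R : ℕ) : State R → ℝ := fun j => 2 / ((R : ℝ) * (R + 1)) * ((j : ℕ) : ℝ)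

/-- The steady-state mean of the number of newly updated nodes. -/
def muU (R : ℕ) : ℝ := ∑ j : State R, ((j : ℕ) : ℝ) * steady R j

/-- The conditional mean `η + (1 - η) / (i + 1)` of an inter-transmission time, given that `i` nodes
have just been updated. -/
def meanTime {R : ℕ} (η : ℝ) (i : State R) : ℝ := η + (1 - η) / (((i : ℕ) : ℝ) + 1)

/-- The steady-state mean of an inter-transmission time. -/
def muTheta (R : ℕ) (η : ℝ) : ℝ := ∑ j : State R, steady R j * meanTime η j

/-- The distribution function of the minimum of `u` independent uniform variables on `[η, 1]`.
For `η = 1` and `u ≥ 1` this is the distribution function of the point mass at `1`. -/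
def timeCDF (η : ℝ) (u : ℕ) (t : ℝ) : ℝ :=
  if t < η then 0 else if t ≤ 1 then 1 - ((1 - t) / (1 - η)) ^ u else 1

/-- The σ-algebra generated by `U 0, …, U m` and `θ 1, …, θ m`. -/
abbrev past {Ω : Type*} {R : ℕ} (U : ℕ → Ω → State R) (θ : ℕ → Ω → ℝ) (m : ℕ) : MeasurableSpace Ω :=
  (⨆ i ∈ Set.Iic m, MeasurableSpace.comap (U i) inferInstance) ⊔
    (⨆ i ∈ Set.Icc 1 m, MeasurableSpace.comap (θ i) inferInstance)

/-- The Markov renewal process of the propagation model, with an arbitrary initial distribution: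
`U m` is the number of nodes updated by the `m`-th broadcast and `θ m`, for `m ≥ 1`, the time between
the broadcasts `m - 1` and `m` (`θ 0` plays no role). Given the past up to the `m`-th broadcast, with
`U m = i`, the variables `U (m + 1)` and `θ (m + 1)` are independent, `U (m + 1)` has distribution
`p i ·` and `θ (m + 1)` is distributed as the minimum of `i` independent uniform timers on `[η, 1]`. -/
structure IsProcess {Ω : Type*} [MeasurableSpace Ω] (R : ℕ) (η : ℝ) (P : Measure Ω)
    (U : ℕ → Ω → State R) (θ : ℕ → Ω → ℝ) : Prop where
  measurable_U : ∀ m, Measurable (U m)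
  measurable_θ : ∀ m, 1 ≤ m → Measurable (θ m)
  step : ∀ (m : ℕ) (A : Set Ω), MeasurableSet[past U θ m] A → ∀ (i j : State R) (t : ℝ),
    P.real (A ∩ {ω | U m ω = i ∧ U (m + 1) ω = j ∧ θ (m + 1) ω ≤ t}) =
      transMatrix R i j * timeCDF η i t * P.real (A ∩ {ω | U m ω = i})

/-- The chain starts in its steady state. -/
def StartsSteady {Ω : Type*} [MeasurableSpace Ω] {R : ℕ} (P : Measure Ω)
    (U : ℕ → Ω → State R) : Prop :=
  ∀ i : State R, P.real {ω | U 0 ω = i} = steady R i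

/-- The number of nodes updated by the `m`-th broadcast, as a real random variable. -/
def num {Ω : Type*} {R : ℕ} (U : ℕ → Ω → State R) (m : ℕ) (ω : Ω) : ℝ := (((U m ω : State R) : ℕ) : ℝ)

/-- The time `T_m = θ_1 + ⋯ + θ_m` of the `m`-th broadcast. -/
def time {Ω : Type*} (θ : ℕ → Ω → ℝ) (m : ℕ) (ω : Ω) : ℝ := ∑ i ∈ Finset.Icc 1 m, θ i ω

/-- The hop count `H^{(n)} = min {m : U_1 + ⋯ + U_m ≥ n}`. -/
def hopCount {Ω : Type*} {R : ℕ} (U : ℕ → Ω → State R) (n : ℕ) (ω : Ω) : ℕ :=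
  sInf {m : ℕ | n ≤ ∑ i ∈ Finset.Icc 1 m, ((U i ω : State R) : ℕ)}

/-- The end-to-end delay `T^{(n)} = θ_1 + ⋯ + θ_{H^{(n)}}`. -/
def delay {Ω : Type*} {R : ℕ} (U : ℕ → Ω → State R) (θ : ℕ → Ω → ℝ) (n : ℕ) (ω : Ω) : ℝ :=
  time θ (hopCount U n ω) ω

/-- The matrix `I - P + 1 π`. -/
def fundamentalInv (R : ℕ) : Matrix (State R) (State R) ℝ :=
  1 - transMatrix R + Matrix.vecMulVec (fun _ => 1) (steady R)

/-- The fundamental matrix `Z = (I - P + 1 π)⁻¹`. -/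
def fundamental (R : ℕ) : Matrix (State R) (State R) ℝ := (fundamentalInv R)⁻¹

/-- The matrix `M = [p i j * (η + (1 - η) / (i + 1))]`. -/
def timeMatrix (R : ℕ) (η : ℝ) : Matrix (State R) (State R) ℝ :=
  Matrix.of fun i j => transMatrix R i j * meanTime η i

/-- `γ_U² = Var[U_0] + 2 ∑_{j ≥ 1} Cov[U_0, U_j]`, for the stationary process. -/
def gammaUSq {Ω : Type*} [MeasurableSpace Ω] {R : ℕ} (P : Measure Ω) (U : ℕ → Ω → State R) : ℝ :=
  Var[num U 0; P] + 2 * ∑' j : ℕ, cov[num U 0, num U (j + 1); P]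

/-- `γ_θ² = Var[θ_1] + 2 π M Z M 1 - 2 μ_θ²`, for the stationary process. -/
def gammaThetaSq {Ω : Type*} [MeasurableSpace Ω] (R : ℕ) (η : ℝ) (P : Measure Ω)
    (θ : ℕ → Ω → ℝ) : ℝ :=
  Var[θ 1; P]
    + 2 * (steady R ⬝ᵥ ((timeMatrix R η * fundamental R * timeMatrix R η) *ᵥ fun _ => 1))
    - 2 * muTheta R η ^ 2

/-- The explicit constant `Δ`. -/
def Delta (R : ℕ) (η : ℝ) : ℝ :=
  (1 - η) * (((4 * (R : ℝ) + 8) * (∑ j ∈ Finset.Icc 1 (R + 1), 1 / (j : ℝ))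
      - ((R : ℝ) ^ 2 + 9 * R + 8)) / (9 * (R : ℝ) ^ 2 + 9 * R))

end Trickle

end

/-! Everything reduces to one statement about the additive functional `a * U + b * θ`. The Poisson
equation for the finite chain provides a corrector, and adding its increments turns the centred
functional into a martingale up to a boundary term bounded uniformly in the initial state
(`corrector_sub_mulVec`, `stopSum_incr`). At a bounded stopping time the second moment of the
martingale is the mean of its bracket (`IsProcess.integral_stopSum_sq`). A second use of the Poisson
equation replaces this by `asympVar R η a b` times the mean of the stopping time, with bounded error
(`IsProcess.abs_integral_occupation_sub_le`). A bounded perturbation changes the variance only on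
the scale of the standard deviation, so variances divided by `n` converge, whatever the initial law
(`IsProcess.tendsto_variance_additive`).

Deterministic times give the limits for `U`, `θ` and their combination. For the delay one stops at
the hop count, with `a = -μ_θ / μ_U` and `b = 1`. The drift then vanishes, and the sum of the `U`'s
is `n` up to a bounded overshoot, so the delay is a martingale plus a constant plus a bounded term.
The mean hop count is `n / μ_U + O(1)`.

It remains to see that `asympVar` is the quadratic form with coefficients `γ_U²`, `γ_θ²` and `Δ`
(`asympVar_eq`, `asympVar_eq_gamma`). The explicit values come from two facts: the chain is
reversible, and the centred state is an eigenvector of the transition matrix with eigenvalue `-1/2`.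
Hence the covariances involving `U` are geometric with ratio `-1/2`. -/

noncomputable section

namespace Trickle

/-! ### The transition matrix: reversibility, eigenvector, Poisson equation, closed form of `Δ`. -/

section

variable {R : ℕ}

theorem one_le_state (i : State R) : 1 ≤ (i : ℕ) := (Finset.mem_Icc.1 i.2).1

theorem state_le (i : State R) : (i : ℕ) ≤ R := (Finset.mem_Icc.1 i.2).2

theorem state_pos (i : State R) : (0 : ℝ) < ((i : ℕ) : ℝ) := by exact_mod_cast one_le_state i

theorem state_le_real (i : State R) : ((i : ℕ) : ℝ) ≤ R := by exact_mod_cast state_le i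

theorem sum_state (F : ℕ → ℝ) : ∑ j : State R, F j = ∑ j ∈ Finset.range R, F (j + 1) := by
  rw [Finset.sum_coe_sort (Finset.Icc 1 R) F, ← Finset.Ico_add_one_right_eq_Icc,
    Finset.sum_Ico_eq_sum_range]
  simp [add_comm]

theorem transMatrix_nonneg (i j : State R) : 0 ≤ transMatrix R i j := by
  simp only [transMatrix, Matrix.of_apply]
  split_ifs <;> positivity

theorem transMatrix_mulVec (i : State R) (F : ℕ → ℝ) :
    (transMatrix R *ᵥ fun j => F j) i = 1 / ((i : ℕ) : ℝ) * ∑ k ∈ Finset.range i, F (R - k) := by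
  have hi := state_le i
  have hi1 := one_le_state i
  simp only [Matrix.mulVec, dotProduct, transMatrix, Matrix.of_apply, ite_mul, zero_mul]
  rw [Finset.sum_coe_sort (Finset.Icc 1 R) (fun j : ℕ =>
    if (R : ℤ) - (i : ℕ) < j ∧ j ≤ R then 1 / ((i : ℕ) : ℝ) * F j else 0), ← Finset.sum_filter,
    ← Finset.mul_sum]
  congr 1
  refine Finset.sum_nbij' (fun j => R - j) (fun k => R - k) ?_ ?_ ?_ ?_ ?_
  all_goals intro a ha; simp only [Finset.mem_filter, Finset.mem_Icc, Finset.mem_range] at ha ⊢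
  · omega
  · omega
  · omega
  · omega
  · congr 1; omega

theorem transMatrix_mulVec_const (c : ℝ) :
    (transMatrix R *ᵥ fun _ => c) = fun _ => c := by
  ext i
  have := state_pos i
  rw [transMatrix_mulVec i (fun _ => c)]
  simp
  field_simp

theorem transMatrix_row_sum (i : State R) : ∑ j, transMatrix R i j = 1 := by
  simpa [Matrix.mulVec, dotProduct] using congrFun (transMatrix_mulVec_const (R := R) 1) i

/-- The next state is uniform on the top `i` states, so its mean is affine in `i`. The slope `-1/2`
is the eigenvalue behind every explicit constant below. -/
theorem transMatrix_mulVec_num (i : State R) :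
    (transMatrix R *ᵥ fun j => ((j : ℕ) : ℝ)) i = (2 * R + 1) / 2 - ((i : ℕ) : ℝ) / 2 := by
  have hpos := state_pos i
  have key : ∀ n ≤ R, ∑ k ∈ Finset.range n, ((R - k : ℕ) : ℝ) = n * (2 * R + 1 - n) / 2 := by
    intro n
    induction n with
    | zero => simp
    | succ n ih =>
      intro hn
      rw [Finset.sum_range_succ, ih (by omega), Nat.cast_sub (by omega)]
      push_cast
      ring
  rw [transMatrix_mulVec i (fun j => (j : ℝ)), key _ (state_le i)]
  field_simp

theorem steady_pos (j : State R) : 0 < steady R j := by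
  have hj := state_pos j
  have : (0 : ℝ) < R := hj.trans_le (state_le_real j)
  unfold steady
  positivity

theorem sum_range_succ_cast (n : ℕ) :
    ∑ j ∈ Finset.range n, ((j + 1 : ℕ) : ℝ) = n * (n + 1) / 2 := by
  induction n with
  | zero => simp
  | succ n ih => rw [Finset.sum_range_succ, ih]; push_cast; ring

theorem sum_range_succ_cast_sq (n : ℕ) :
    ∑ j ∈ Finset.range n, ((j + 1 : ℕ) : ℝ) * ((j + 1 : ℕ) : ℝ) =
      n * (n + 1) * (2 * n + 1) / 6 := by
  induction n with
  | zero => simp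
  | succ n ih => rw [Finset.sum_range_succ, ih]; push_cast; ring

theorem steady_sum (hR : 1 ≤ R) : ∑ j, steady R j = 1 := by
  have : (0 : ℝ) < R := by exact_mod_cast hR
  simp only [steady]
  rw [← Finset.mul_sum, sum_state (fun j => (j : ℝ)), sum_range_succ_cast]
  field_simp

theorem muU_eq (hR : 1 ≤ R) : muU R = (2 * R + 1) / 3 := by
  have : (0 : ℝ) < R := by exact_mod_cast hR
  simp only [muU, steady]
  have : ∀ j : State R, ((j : ℕ) : ℝ) * (2 / ((R : ℝ) * (R + 1)) * ((j : ℕ) : ℝ)) =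
      2 / ((R : ℝ) * (R + 1)) * (((j : ℕ) : ℝ) * ((j : ℕ) : ℝ)) := fun j => by ring
  simp only [this]
  rw [← Finset.mul_sum, sum_state (fun j => (j : ℝ) * (j : ℝ)), sum_range_succ_cast_sq]
  field_simp
  ring

theorem muU_pos (hR : 1 ≤ R) : 0 < muU R := by
  rw [muU_eq hR]
  positivity

theorem muU_eq_dotProduct : muU R = steady R ⬝ᵥ fun j => ((j : ℕ) : ℝ) := by
  simp [muU, dotProduct, mul_comm]

/-- The factor `i` in the stationary weight cancels the `1 / i` of the transition, and the condition
`R < i + j` is symmetric. -/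
theorem detailed_balance (i j : State R) :
    steady R i * transMatrix R i j = steady R j * transMatrix R j i := by
  have hi := state_pos i
  have hj := state_pos j
  have h1 := state_le i
  have h2 := state_le j
  simp only [steady, transMatrix, Matrix.of_apply]
  by_cases h : R < (i : ℕ) + j
  · rw [if_pos ⟨by omega, h2⟩, if_pos ⟨by omega, h1⟩]
    field_simp
  · rw [if_neg (by omega), if_neg (by omega)]
    simp

theorem steady_dotProduct_mul_mulVec (f h : State R → ℝ) :
    steady R ⬝ᵥ (f * (transMatrix R *ᵥ h)) = steady R ⬝ᵥ ((transMatrix R *ᵥ f) * h) := by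
  simp only [dotProduct, Matrix.mulVec, Pi.mul_apply, Finset.mul_sum, Finset.sum_mul]
  rw [Finset.sum_comm]
  refine Finset.sum_congr rfl fun j _ => Finset.sum_congr rfl fun i _ => ?_
  linear_combination f i * h j * detailed_balance i j

theorem steady_dotProduct_mulVec (h : State R → ℝ) :
    steady R ⬝ᵥ (transMatrix R *ᵥ h) = steady R ⬝ᵥ h := by
  have := steady_dotProduct_mul_mulVec (fun _ => 1) h
  rw [transMatrix_mulVec_const] at this
  simpa [Pi.mul_def] using this

theorem steady_dotProduct_const (hR : 1 ≤ R) (c : ℝ) : steady R ⬝ᵥ (fun _ => c) = c := by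
  simp only [dotProduct]
  rw [← Finset.sum_mul, steady_sum hR, one_mul]

/-- The Dirichlet form of the chain. -/
theorem dirichlet_form (x : State R → ℝ) :
    ∑ i, ∑ j, steady R i * transMatrix R i j * (x i - x j) ^ 2 =
      2 * (steady R ⬝ᵥ (x * (x - transMatrix R *ᵥ x))) := by
  have e1 : ∑ i, ∑ j, steady R i * transMatrix R i j * x i ^ 2 = steady R ⬝ᵥ (x * x) := by
    simp only [dotProduct, Pi.mul_apply]
    refine Finset.sum_congr rfl fun i _ => ?_
    rw [← Finset.sum_mul, ← Finset.mul_sum, transMatrix_row_sum]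
    ring
  have e2 : ∑ i, ∑ j, steady R i * transMatrix R i j * x j ^ 2 = steady R ⬝ᵥ (x * x) := by
    rw [← steady_dotProduct_mulVec (x * x)]
    simp only [dotProduct, Pi.mul_apply, Matrix.mulVec, Finset.mul_sum]
    refine Finset.sum_congr rfl fun i _ => Finset.sum_congr rfl fun j _ => ?_
    ring
  have e3 : ∑ i, ∑ j, steady R i * transMatrix R i j * (x i * x j) =
      steady R ⬝ᵥ (x * (transMatrix R *ᵥ x)) := by
    simp only [dotProduct, Pi.mul_apply, Matrix.mulVec, Finset.mul_sum]
    refine Finset.sum_congr rfl fun i _ => Finset.sum_congr rfl fun j _ => ?_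
    ring
  have e4 : ∑ i, ∑ j, steady R i * transMatrix R i j * (x i - x j) ^ 2 =
      ∑ i, ∑ j, steady R i * transMatrix R i j * x i ^ 2 +
      ∑ i, ∑ j, steady R i * transMatrix R i j * x j ^ 2 -
      2 * ∑ i, ∑ j, steady R i * transMatrix R i j * (x i * x j) := by
    simp only [Finset.mul_sum, ← Finset.sum_add_distrib, ← Finset.sum_sub_distrib]
    refine Finset.sum_congr rfl fun i _ => Finset.sum_congr rfl fun j _ => ?_
    ring
  rw [e4, e1, e2, e3, mul_sub, dotProduct_sub]
  ring

/-- The Dirichlet form of a harmonic function vanishes, and every state jumps to the state `R` with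
positive probability, so each value equals the one at `R`. -/
theorem eq_of_mulVec_eq_self {x : State R → ℝ} (hx : transMatrix R *ᵥ x = x) (i j : State R) :
    x i = x j := by
  have hRpos : 1 ≤ R := (one_le_state i).trans (state_le i)
  have h0 := dirichlet_form x
  rw [hx, sub_self, mul_zero, dotProduct_zero, mul_zero] at h0
  have hnn : ∀ i j, 0 ≤ steady R i * transMatrix R i j * (x i - x j) ^ 2 := fun i j =>
    mul_nonneg (mul_nonneg (steady_pos i).le (transMatrix_nonneg i j)) (sq_nonneg _)
  have h1 : ∀ i j, steady R i * transMatrix R i j * (x i - x j) ^ 2 = 0 := fun i j =>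
    (Finset.sum_eq_zero_iff_of_nonneg fun j _ => hnn i j).1
      ((Finset.sum_eq_zero_iff_of_nonneg fun i _ => Finset.sum_nonneg fun j _ => hnn i j).1 h0 i
        (Finset.mem_univ _)) j (Finset.mem_univ _)
  have h2 : ∀ i : State R, x i = x ⟨R, Finset.mem_Icc.2 ⟨hRpos, le_rfl⟩⟩ := by
    intro i
    have hi := one_le_state i
    have hp : transMatrix R i ⟨R, Finset.mem_Icc.2 ⟨hRpos, le_rfl⟩⟩ ≠ 0 := by
      have := state_pos i
      simp only [transMatrix, Matrix.of_apply]
      rw [if_pos ⟨by simp; omega, le_rfl⟩]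
      positivity
    have := h1 i ⟨R, Finset.mem_Icc.2 ⟨hRpos, le_rfl⟩⟩
    have h3 := (mul_eq_zero.1 this).resolve_left (mul_ne_zero (steady_pos i).ne' hp)
    exact sub_eq_zero.1 (pow_eq_zero_iff (two_ne_zero) |>.1 h3)
  rw [h2 i, h2 j]

theorem fundamentalInv_mulVec (x : State R → ℝ) :
    fundamentalInv R *ᵥ x = fun i => x i - (transMatrix R *ᵥ x) i + steady R ⬝ᵥ x := by
  ext i
  simp [fundamentalInv, Matrix.add_mulVec, Matrix.sub_mulVec, Matrix.vecMulVec_mulVec]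

/-- Pairing a kernel vector with the stationary law shows that it has mean zero. It is then
harmonic, hence constant, hence zero. -/
theorem isUnit_fundamentalInv (hR : 1 ≤ R) : IsUnit (fundamentalInv R) := by
  rw [← Matrix.mulVec_injective_iff_isUnit]
  refine (injective_iff_map_eq_zero (Matrix.mulVecLin (fundamentalInv R))).2 fun x hx => ?_
  rw [Matrix.mulVecLin_apply, fundamentalInv_mulVec] at hx
  have h0 : steady R ⬝ᵥ x = 0 := by
    have h1 := congrArg (fun y => steady R ⬝ᵥ y) hx
    have h2 : (fun i => x i - (transMatrix R *ᵥ x) i + steady R ⬝ᵥ x) =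
      x - transMatrix R *ᵥ x + fun _ => steady R ⬝ᵥ x := rfl
    simpa only [h2, dotProduct_add, dotProduct_sub, steady_dotProduct_mulVec, sub_self, zero_add,
      steady_dotProduct_const hR, dotProduct_zero] using h1
  have h1 : transMatrix R *ᵥ x = x := by
    ext i
    have := congrFun hx i
    simp only [h0, add_zero, Pi.zero_apply] at this
    linarith
  ext i
  have h2 : x = fun _ => x i := funext fun j => eq_of_mulVec_eq_self h1 j i
  rw [h2, steady_dotProduct_const hR] at h0
  simpa using h0

/-- The centred solution of the Poisson equation `ψ - P ψ = h - π h`. -/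
def poisson (R : ℕ) (h : State R → ℝ) : State R → ℝ :=
  fundamental R *ᵥ fun i => h i - steady R ⬝ᵥ h

theorem fundamentalInv_mulVec_fundamental (hR : 1 ≤ R) (x : State R → ℝ) :
    fundamentalInv R *ᵥ (fundamental R *ᵥ x) = x := by
  rw [Matrix.mulVec_mulVec, fundamental,
    Matrix.mul_nonsing_inv _ ((Matrix.isUnit_iff_isUnit_det _).1 (isUnit_fundamentalInv hR)),
    Matrix.one_mulVec]

theorem fundamental_mulVec_fundamentalInv (hR : 1 ≤ R) (x : State R → ℝ) :
    fundamental R *ᵥ (fundamentalInv R *ᵥ x) = x := by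
  rw [Matrix.mulVec_mulVec, fundamental,
    Matrix.nonsing_inv_mul _ ((Matrix.isUnit_iff_isUnit_det _).1 (isUnit_fundamentalInv hR)),
    Matrix.one_mulVec]

theorem steady_dotProduct_fundamental (hR : 1 ≤ R) (x : State R → ℝ) :
    steady R ⬝ᵥ (fundamental R *ᵥ x) = steady R ⬝ᵥ x := by
  have h2 : ∀ y : State R → ℝ, (fun i => y i - (transMatrix R *ᵥ y) i + steady R ⬝ᵥ y) =
      y - transMatrix R *ᵥ y + fun _ => steady R ⬝ᵥ y := fun _ => rfl
  conv_rhs => rw [← fundamentalInv_mulVec_fundamental hR x, fundamentalInv_mulVec, h2]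
  rw [dotProduct_add, dotProduct_sub, steady_dotProduct_mulVec, steady_dotProduct_const hR]
  ring

theorem steady_dotProduct_centered (hR : 1 ≤ R) (h : State R → ℝ) :
    (steady R ⬝ᵥ fun i => h i - steady R ⬝ᵥ h) = 0 := by
  have : (fun i => h i - steady R ⬝ᵥ h) = h - fun _ => steady R ⬝ᵥ h := rfl
  rw [this, dotProduct_sub, steady_dotProduct_const hR, sub_self]

theorem steady_dotProduct_poisson (hR : 1 ≤ R) (h : State R → ℝ) :
    steady R ⬝ᵥ poisson R h = 0 := by
  rw [poisson, steady_dotProduct_fundamental hR, steady_dotProduct_centered hR]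

theorem poisson_sub_mulVec (hR : 1 ≤ R) (h : State R → ℝ) (i : State R) :
    poisson R h i - (transMatrix R *ᵥ poisson R h) i = h i - steady R ⬝ᵥ h := by
  have h1 := congrFun (fundamentalInv_mulVec_fundamental hR fun i => h i - steady R ⬝ᵥ h) i
  rw [fundamentalInv_mulVec] at h1
  change poisson R h i - (transMatrix R *ᵥ poisson R h) i + steady R ⬝ᵥ poisson R h = _ at h1
  rwa [steady_dotProduct_poisson hR, add_zero] at h1

theorem fundamental_mulVec (hR : 1 ≤ R) (h : State R → ℝ) :
    fundamental R *ᵥ h = fun i => poisson R h i + steady R ⬝ᵥ h := by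
  have h1 : fundamentalInv R *ᵥ (fun i => poisson R h i + steady R ⬝ᵥ h) = h := by
    ext i
    have e : (fun i => poisson R h i + steady R ⬝ᵥ h) =
      poisson R h + fun _ => steady R ⬝ᵥ h := rfl
    rw [fundamentalInv_mulVec, e, dotProduct_add, Matrix.mulVec_add, steady_dotProduct_poisson hR,
      transMatrix_mulVec_const, steady_dotProduct_const hR]
    have := poisson_sub_mulVec hR h i
    simp only [Pi.add_apply]
    linarith
  rw [← fundamental_mulVec_fundamentalInv hR (fun i => poisson R h i + steady R ⬝ᵥ h), h1]

theorem mulVec_num_centered (hR : 1 ≤ R) (i : State R) :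
    (transMatrix R *ᵥ fun j => ((j : ℕ) : ℝ) - muU R) i =
      -(1 / 2) * (((i : ℕ) : ℝ) - muU R) := by
  have e : (fun j : State R => ((j : ℕ) : ℝ) - muU R) =
    (fun j : State R => ((j : ℕ) : ℝ)) - fun _ => muU R := rfl
  rw [e, Matrix.mulVec_sub, transMatrix_mulVec_const, Pi.sub_apply, transMatrix_mulVec_num,
    muU_eq hR]
  ring

/-- Reversibility moves the transition matrix onto the eigenvector, whatever `h` is. -/
theorem steady_dotProduct_num_mul_mulVec (hR : 1 ≤ R) (h : State R → ℝ) :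
    steady R ⬝ᵥ ((fun j : State R => ((j : ℕ) : ℝ) - muU R) * (transMatrix R *ᵥ h)) =
      -(1 / 2) * (steady R ⬝ᵥ ((fun j : State R => ((j : ℕ) : ℝ) - muU R) * h)) := by
  rw [steady_dotProduct_mul_mulVec, ← smul_eq_mul (-(1 / 2 : ℝ)), ← dotProduct_smul]
  congr 1
  ext i
  rw [Pi.mul_apply, mulVec_num_centered hR]
  simp [mul_assoc]

theorem steady_dotProduct_centered_mul (f g : State R → ℝ) :
    steady R ⬝ᵥ ((fun i => f i - steady R ⬝ᵥ f) * g) =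
      steady R ⬝ᵥ (f * g) - (steady R ⬝ᵥ f) * (steady R ⬝ᵥ g) := by
  have e : (fun i => f i - steady R ⬝ᵥ f) * g = f * g - (steady R ⬝ᵥ f) • g := by
    ext i
    simp
    ring
  rw [e, dotProduct_sub, dotProduct_smul, smul_eq_mul]

theorem sum_steady_div_succ :
    ∑ j : State R, steady R j * (1 / (((j : ℕ) : ℝ) + 1)) =
      2 / ((R : ℝ) * (R + 1)) * (R + 1 - ∑ j ∈ Finset.Icc 1 (R + 1), 1 / (j : ℝ)) := by
  -- Since `j / (j + 1) = 1 - 1 / (j + 1)`, this is where the harmonic sum of `Δ` arises.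
  have e : ∀ n : ℕ, ∑ j ∈ Finset.range n, (((j + 1 : ℕ) : ℝ) * (1 / (((j + 1 : ℕ) : ℝ) + 1))) =
      n + 1 - ∑ j ∈ Finset.Icc 1 (n + 1), 1 / (j : ℝ) := by
    intro n
    induction n with
    | zero => simp
    | succ n ih =>
      rw [Finset.sum_range_succ, ih, Finset.sum_Icc_succ_top (a := 1) (b := n + 1) (by omega)]
      push_cast
      field_simp
      ring
  simp only [steady, mul_assoc]
  rw [← Finset.mul_sum, sum_state (fun j => (j : ℝ) * (1 / ((j : ℝ) + 1))), e]

theorem Delta_eq (hR : 1 ≤ R) (η : ℝ) :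
    Delta R η = 1 / 3 * (steady R ⬝ᵥ ((fun j : State R => ((j : ℕ) : ℝ) - muU R) * meanTime η)) := by
  have hR' : (0 : ℝ) < R := by exact_mod_cast hR
  have h1 : steady R ⬝ᵥ ((fun j : State R => ((j : ℕ) : ℝ) - muU R) * meanTime η) =
      ∑ j : State R, (η * (((j : ℕ) : ℝ) * steady R j) - η * muU R * steady R j +
        (1 - η) * steady R j - (1 - η) * (1 + muU R) *
          (steady R j * (1 / (((j : ℕ) : ℝ) + 1)))) := by
    refine Finset.sum_congr rfl fun j _ => ?_
    have := state_pos j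
    simp only [Pi.mul_apply, meanTime]
    field_simp
    ring
  rw [h1, Finset.sum_sub_distrib, Finset.sum_add_distrib, Finset.sum_sub_distrib,
    ← Finset.mul_sum, ← Finset.mul_sum, ← Finset.mul_sum, ← Finset.mul_sum, steady_sum hR,
    sum_steady_div_succ, ← muU, Delta, muU_eq hR]
  field_simp
  ring

end

/-! ### The law of the minimum of `u` uniform timers. -/

section

/-- The quantile transform of the minimum of `u` independent uniform variables on `[η, 1]`. -/
def timeQuantile (η : ℝ) (u : ℕ) (s : ℝ) : ℝ := 1 - (1 - η) * s ^ ((u : ℝ)⁻¹)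

/-- The law of the minimum of `u` independent uniform variables on `[η, 1]`, for `u ≥ 1`. -/
def timeLaw (η : ℝ) (u : ℕ) : Measure ℝ :=
  (volume.restrict (Set.Ioc (0 : ℝ) 1)).map (timeQuantile η u)

theorem measurable_timeQuantile (η : ℝ) (u : ℕ) : Measurable (timeQuantile η u) := by
  unfold timeQuantile
  fun_prop

instance isProbabilityMeasure_timeLaw (η : ℝ) (u : ℕ) : IsProbabilityMeasure (timeLaw η u) := by
  have : IsProbabilityMeasure (volume.restrict (Set.Ioc (0 : ℝ) 1)) := ⟨by simp⟩
  exact Measure.isProbabilityMeasure_map (measurable_timeQuantile η u).aemeasurable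

theorem timeQuantile_mem {η : ℝ} (hη : η ∈ Set.Icc (0 : ℝ) 1) (u : ℕ) {s : ℝ}
    (hs : s ∈ Set.Ioc (0 : ℝ) 1) : timeQuantile η u s ∈ Set.Icc η 1 := by
  have h0 : 0 ≤ s ^ ((u : ℝ)⁻¹) := Real.rpow_nonneg hs.1.le _
  have h1 : s ^ ((u : ℝ)⁻¹) ≤ 1 := Real.rpow_le_one hs.1.le hs.2 (by positivity)
  have h2 : 0 ≤ 1 - η := sub_nonneg.2 hη.2
  unfold timeQuantile
  constructor <;> nlinarith

theorem ae_timeLaw_mem {η : ℝ} (hη : η ∈ Set.Icc (0 : ℝ) 1) (u : ℕ) :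
    ∀ᵐ t ∂timeLaw η u, t ∈ Set.Icc (0 : ℝ) 1 := by
  rw [timeLaw, ae_map_iff (p := fun t => t ∈ Set.Icc (0 : ℝ) 1) (measurable_timeQuantile η u).aemeasurable
      measurableSet_Icc,
    ae_restrict_iff' measurableSet_Ioc]
  exact ae_of_all _ fun s hs => Set.Icc_subset_Icc_left hη.1 (timeQuantile_mem hη u hs)

/-- The uniform variable `s` plays the role of the survival probability: the quantile is at most `t`
exactly when `s` is at least `((1 - t) / (1 - η)) ^ u`. -/
theorem timeLaw_real_Iic {η : ℝ} (hη : η ∈ Set.Icc (0 : ℝ) 1) {u : ℕ} (hu : 1 ≤ u) (t : ℝ) :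
    (timeLaw η u).real (Set.Iic t) = timeCDF η u t := by
  have hu0 : (0 : ℝ) < u := by exact_mod_cast hu
  rw [timeLaw, map_measureReal_apply (measurable_timeQuantile η u) measurableSet_Iic,
    measureReal_restrict_apply (measurable_timeQuantile η u measurableSet_Iic)]
  unfold timeCDF
  split_ifs with h1 h2
  · have : timeQuantile η u ⁻¹' Set.Iic t ∩ Set.Ioc 0 1 = ∅ := by
      ext s
      simp only [Set.mem_inter_iff, Set.mem_preimage, Set.mem_Iic, Set.mem_empty_iff_false,
        iff_false, not_and]
      intro hs hs2
      exact absurd (timeQuantile_mem hη u hs2).1 (by linarith)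
    rw [this, measureReal_empty]
  · push Not at h1
    rcases hη.2.eq_or_lt with h3 | h3
    · have ht : t = 1 := by linarith
      have : timeQuantile η u ⁻¹' Set.Iic t ∩ Set.Ioc 0 1 = Set.Ioc 0 1 := by
        ext s
        simp [timeQuantile, h3, ht]
      rw [this, ht]
      simp [zero_pow (by omega : u ≠ 0)]
    · have hr : 0 ≤ (1 - t) / (1 - η) := div_nonneg (by linarith) (by linarith)
      have hr1 : (1 - t) / (1 - η) ≤ 1 := (div_le_one (by linarith)).2 (by linarith)
      have key : ∀ s ∈ Set.Ioc (0 : ℝ) 1, timeQuantile η u s ≤ t ↔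
          ((1 - t) / (1 - η)) ^ u ≤ s := by
        intro s hs
        rw [timeQuantile, ← Real.rpow_natCast, ← Real.le_rpow_inv_iff_of_pos hr hs.1.le hu0,
          div_le_iff₀ (by linarith)]
        constructor <;> intro h <;> linarith
      have : timeQuantile η u ⁻¹' Set.Iic t ∩ Set.Ioc 0 1 =
          Set.Icc (((1 - t) / (1 - η)) ^ u) 1 ∩ Set.Ioc 0 1 := by
        ext s
        simp only [Set.mem_inter_iff, Set.mem_preimage, Set.mem_Iic, Set.mem_Icc]
        constructor
        · rintro ⟨h, hs⟩
          exact ⟨⟨(key s hs).1 h, hs.2⟩, hs⟩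
        · rintro ⟨h, hs⟩
          exact ⟨(key s hs).2 h.1, hs⟩
      have h5 : (Set.Icc (((1 - t) / (1 - η)) ^ u) 1 ∩ Set.Ioc 0 1 : Set ℝ) =ᵐ[volume]
          (Set.Ioc (((1 - t) / (1 - η)) ^ u) 1 : Set ℝ) := by
        have h6 : Set.Ioc (((1 - t) / (1 - η)) ^ u) 1 ∩ Set.Ioc 0 1 =
            Set.Ioc (((1 - t) / (1 - η)) ^ u) 1 :=
          Set.inter_eq_left.2 (Set.Ioc_subset_Ioc_left (pow_nonneg hr u))
        conv_rhs => rw [← h6]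
        exact Ioc_ae_eq_Icc.symm.inter (ae_eq_refl _)
      rw [this, measureReal_congr h5, Real.volume_real_Ioc_of_le (pow_le_one₀ hr hr1)]
  · have : timeQuantile η u ⁻¹' Set.Iic t ∩ Set.Ioc 0 1 = Set.Ioc 0 1 := by
      refine Set.inter_eq_right.2 fun s hs => ?_
      have := (timeQuantile_mem hη u hs).2
      simp only [Set.mem_preimage, Set.mem_Iic]
      linarith
    rw [this]
    simp

theorem integral_timeLaw_id {η : ℝ} {R : ℕ} (i : State R) :
    ∫ t, t ∂timeLaw η i = meanTime η i := by
  have hi := state_pos i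
  rw [timeLaw, integral_map (measurable_timeQuantile η i).aemeasurable (by fun_prop),
    ← intervalIntegral.integral_of_le zero_le_one]
  unfold timeQuantile
  have h1 : (-1 : ℝ) < (((i : ℕ) : ℝ))⁻¹ := by
    have : 0 < (((i : ℕ) : ℝ))⁻¹ := by positivity
    linarith
  rw [intervalIntegral.integral_sub (by simp)
    ((intervalIntegral.intervalIntegrable_rpow' h1).const_mul _),
    intervalIntegral.integral_const_mul, integral_rpow (Or.inl h1)]
  rw [Real.zero_rpow (by positivity)]
  simp only [intervalIntegral.integral_const, Real.one_rpow, meanTime]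
  field_simp
  simp
  ring

theorem memLp_timeLaw_id {η : ℝ} (hη : η ∈ Set.Icc (0 : ℝ) 1) (u : ℕ) (p : ENNReal) :
    MemLp (fun t : ℝ => t) p (timeLaw η u) := by
  refine MemLp.of_bound (by fun_prop) 1 ?_
  filter_upwards [ae_timeLaw_mem hη u] with t ht
  rw [Real.norm_eq_abs, abs_le]
  constructor <;> linarith [ht.1, ht.2]

end

/-! ### From the defining step property to conditional expectations given the past. -/

section

variable {R : ℕ} {η : ℝ} {Ω : Type*} {U : ℕ → Ω → State R} {θ : ℕ → Ω → ℝ}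

theorem measurable_U_past {i m : ℕ} (h : i ≤ m) : Measurable[past U θ m] (U i) :=
  Measurable.of_comap_le <|
    (le_iSup₂_of_le (f := fun i (_ : i ∈ Set.Iic m) => MeasurableSpace.comap (U i) inferInstance)
      i h le_rfl).trans le_sup_left

theorem measurable_θ_past {i m : ℕ} (h1 : 1 ≤ i) (h : i ≤ m) : Measurable[past U θ m] (θ i) :=
  Measurable.of_comap_le <|
    (le_iSup₂_of_le (f := fun i (_ : i ∈ Set.Icc 1 m) => MeasurableSpace.comap (θ i) inferInstance)
      i ⟨h1, h⟩ le_rfl).trans le_sup_right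

theorem past_mono {m n : ℕ} (h : m ≤ n) : past U θ m ≤ past U θ n :=
  sup_le_sup (biSup_mono fun _ hi => le_trans (Set.mem_Iic.1 hi) h)
    (biSup_mono fun _ hi => ⟨hi.1, hi.2.trans h⟩)

/-- The transition event from `i` to `j` at step `m`. -/
def transEvent (U : ℕ → Ω → State R) (m : ℕ) (z : State R × State R) : Set Ω :=
  {ω | U m ω = z.1 ∧ U (m + 1) ω = z.2}

theorem iUnion_transEvent (U : ℕ → Ω → State R) (m : ℕ) : ⋃ z, transEvent U m z = Set.univ := by
  ext ω
  simp [transEvent]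

theorem pairwise_disjoint_transEvent (U : ℕ → Ω → State R) (m : ℕ) :
    Pairwise (Function.onFun Disjoint (transEvent U m)) := by
  intro z w hzw
  refine Set.disjoint_left.2 fun ω h1 h2 => hzw ?_
  exact Prod.ext (h1.1.symm.trans h2.1) (h1.2.symm.trans h2.2)

variable [mΩ : MeasurableSpace Ω] {P : Measure Ω}

theorem IsProcess.past_le (hX : IsProcess R η P U θ) (m : ℕ) : past U θ m ≤ mΩ :=
  sup_le (iSup₂_le fun i _ => (hX.measurable_U i).comap_le)
    (iSup₂_le fun i hi => (hX.measurable_θ i hi.1).comap_le)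

theorem IsProcess.measurableSet_transEvent (hX : IsProcess R η P U θ) (m : ℕ)
    (z : State R × State R) : MeasurableSet (transEvent U m z) :=
  (hX.measurable_U m (measurableSet_singleton z.1)).inter
    (hX.measurable_U (m + 1) (measurableSet_singleton z.2))

theorem IsProcess.memLp_comp (hX : IsProcess R η P U θ) (h : State R → ℝ) (m : ℕ) :
    MemLp (fun ω => h (U m ω)) ⊤ P :=
  memLp_top_of_bound (C := ∑ i, |h i|)
    (((measurable_of_finite h).comp (hX.measurable_U m)).aestronglyMeasurable)
    (ae_of_all _ fun ω => Finset.single_le_sum (f := fun i => |h i|) (fun _ _ => abs_nonneg _)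
      (Finset.mem_univ (U m ω)))

theorem memLp_top_mul {X Y : Ω → ℝ} (hX : MemLp X ⊤ P) (hY : MemLp Y ⊤ P) :
    MemLp (fun ω => X ω * Y ω) ⊤ P := hY.mul' hX

variable [IsProbabilityMeasure P]

/-- The step property only concerns half-lines, but these determine a finite measure on the line.
That `timeLaw η z.1` does not involve `z.2` expresses the conditional independence of duration and
next state. -/
theorem IsProcess.map_restrict (hX : IsProcess R η P U θ) (hη : η ∈ Set.Icc (0 : ℝ) 1) (m : ℕ)
    {A : Set Ω} (hA : MeasurableSet[past U θ m] A) (z : State R × State R) :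
    (P.restrict (A ∩ transEvent U m z)).map (θ (m + 1)) =
      ENNReal.ofReal (transMatrix R z.1 z.2 * P.real (A ∩ {ω | U m ω = z.1})) •
        timeLaw η z.1 := by
  have hθ := hX.measurable_θ (m + 1) (by omega)
  have hc : 0 ≤ transMatrix R z.1 z.2 * P.real (A ∩ {ω | U m ω = z.1}) :=
    mul_nonneg (transMatrix_nonneg _ _) measureReal_nonneg
  refine Measure.ext_of_Iic _ _ fun t => ?_
  rw [Measure.map_apply hθ measurableSet_Iic,
    Measure.restrict_apply (hθ measurableSet_Iic), Measure.smul_apply, smul_eq_mul,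
    ← ENNReal.toReal_eq_toReal_iff' (by finiteness) (by finiteness), ENNReal.toReal_mul,
    ENNReal.toReal_ofReal hc]
  change P.real _ = _ * (timeLaw η z.1).real (Set.Iic t)
  rw [timeLaw_real_Iic hη (one_le_state _)]
  have := hX.step m A hA z.1 z.2 t
  rw [mul_right_comm] at this
  rw [← this]
  congr 1
  ext ω
  simp only [transEvent, Set.mem_inter_iff, Set.mem_preimage, Set.mem_Iic, Set.mem_ofPred_eq]
  tauto

theorem IsProcess.ae_θ_mem (hX : IsProcess R η P U θ) (hη : η ∈ Set.Icc (0 : ℝ) 1) :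
    ∀ᵐ ω ∂P, ∀ m, θ (m + 1) ω ∈ Set.Icc (0 : ℝ) 1 := by
  rw [ae_all_iff]
  intro m
  have h1 : ∀ z, ∀ᵐ ω ∂P.restrict (transEvent U m z), θ (m + 1) ω ∈ Set.Icc (0 : ℝ) 1 := by
    intro z
    have h2 := hX.map_restrict hη m (A := Set.univ) MeasurableSet.univ z
    rw [Set.univ_inter] at h2
    have h3 : ∀ᵐ t ∂(P.restrict (transEvent U m z)).map (θ (m + 1)), t ∈ Set.Icc (0 : ℝ) 1 := by
      rw [h2]
      exact Measure.ae_smul_measure (ae_timeLaw_mem hη _) _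
    exact ae_of_ae_map (hX.measurable_θ (m + 1) (by omega)).aemeasurable h3
  rw [← Measure.restrict_univ (μ := P), ← iUnion_transEvent U m, ae_restrict_iUnion_iff]
  exact h1

/-- The conditional mean of `G (U m) (U (m + 1)) (θ (m + 1))` given that `U m = i`. -/
def stepMean (R : ℕ) (η : ℝ) (G : State R → State R → ℝ → ℝ) (i : State R) : ℝ :=
  ∑ j, transMatrix R i j * ∫ t, G i j t ∂timeLaw η i

/-- Both sides are split over the finitely many transitions. On each one the integrand depends on
the duration alone, whose law is known. -/
theorem IsProcess.setIntegral_step (hX : IsProcess R η P U θ) (hη : η ∈ Set.Icc (0 : ℝ) 1) (m : ℕ)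
    {G : State R → State R → ℝ → ℝ} (hG : ∀ i j, Measurable (G i j))
    (hint : Integrable (fun ω => G (U m ω) (U (m + 1) ω) (θ (m + 1) ω)) P)
    {A : Set Ω} (hA : MeasurableSet[past U θ m] A) :
    ∫ ω in A, stepMean R η G (U m ω) ∂P =
      ∫ ω in A, G (U m ω) (U (m + 1) ω) (θ (m + 1) ω) ∂P := by
  have hA' := hX.past_le m A hA
  have hθ := hX.measurable_θ (m + 1) (by omega)
  have h1 : ∫ ω in A, G (U m ω) (U (m + 1) ω) (θ (m + 1) ω) ∂P =
      ∑ z, ∫ ω in A ∩ transEvent U m z, G (U m ω) (U (m + 1) ω) (θ (m + 1) ω) ∂P := by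
    rw [← integral_iUnion_fintype (fun z => hA'.inter (hX.measurableSet_transEvent m z))
      (fun z w hzw => (pairwise_disjoint_transEvent U m hzw).mono Set.inter_subset_right
        Set.inter_subset_right) (fun z => hint.integrableOn), ← Set.inter_iUnion,
      iUnion_transEvent, Set.inter_univ]
  have h2 : ∀ z : State R × State R,
      ∫ ω in A ∩ transEvent U m z, G (U m ω) (U (m + 1) ω) (θ (m + 1) ω) ∂P =
        transMatrix R z.1 z.2 * P.real (A ∩ {ω | U m ω = z.1}) *
          ∫ t, G z.1 z.2 t ∂timeLaw η z.1 := by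
    intro z
    have h3 : ∫ ω in A ∩ transEvent U m z, G (U m ω) (U (m + 1) ω) (θ (m + 1) ω) ∂P =
        ∫ ω in A ∩ transEvent U m z, G z.1 z.2 (θ (m + 1) ω) ∂P := by
      refine setIntegral_congr_fun (hA'.inter (hX.measurableSet_transEvent m z)) fun ω hω => ?_
      simp only [hω.2.1, hω.2.2]
    rw [h3, ← integral_map hθ.aemeasurable (hG z.1 z.2).aestronglyMeasurable,
      hX.map_restrict hη m hA z, integral_smul_measure, ENNReal.toReal_ofReal
        (mul_nonneg (transMatrix_nonneg _ _) measureReal_nonneg), smul_eq_mul]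
  have hAi : ∀ i, MeasurableSet (A ∩ {ω | U m ω = i}) := fun i =>
    hA'.inter (hX.measurable_U m (measurableSet_singleton i))
  have h4 : ∫ ω in A, stepMean R η G (U m ω) ∂P =
      ∑ i, ∫ ω in A ∩ {ω | U m ω = i}, stepMean R η G (U m ω) ∂P := by
    rw [← integral_iUnion_fintype hAi
      (fun i j hij => Set.disjoint_left.2 fun ω h h' => hij (h.2.symm.trans h'.2))
      (fun i => ?_), ← Set.inter_iUnion]
    · congr 2
      ext ω
      simp
    · exact ((hX.memLp_comp (stepMean R η G) m).integrable le_top).integrableOn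
  have h5 : ∀ i, ∫ ω in A ∩ {ω | U m ω = i}, stepMean R η G (U m ω) ∂P =
      P.real (A ∩ {ω | U m ω = i}) * stepMean R η G i := by
    intro i
    rw [setIntegral_congr_fun (f := fun ω => stepMean R η G (U m ω))
      (g := fun _ => stepMean R η G i) (hAi i) (fun ω hω => by simp only [show U m ω = i from hω.2])]
    simp
  rw [h1, h4, Fintype.sum_prod_type]
  refine Finset.sum_congr rfl fun i _ => ?_
  rw [h5, stepMean, Finset.mul_sum]
  refine Finset.sum_congr rfl fun j _ => ?_
  rw [h2]
  ring

theorem IsProcess.memLp_θ (hX : IsProcess R η P U θ) (hη : η ∈ Set.Icc (0 : ℝ) 1) (m : ℕ) :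
    MemLp (θ (m + 1)) ⊤ P := by
  refine memLp_top_of_bound (hX.measurable_θ (m + 1) (by omega)).aestronglyMeasurable 1 ?_
  filter_upwards [hX.ae_θ_mem hη] with ω hω
  rw [Real.norm_eq_abs, abs_le]
  constructor <;> linarith [(hω m).1, (hω m).2]

/-- A continuous function of a transition and of its duration is bounded. -/
theorem IsProcess.memLp_step (hX : IsProcess R η P U θ) (hη : η ∈ Set.Icc (0 : ℝ) 1) (m : ℕ)
    {G : State R → State R → ℝ → ℝ} (hG : ∀ i j, Continuous (G i j)) :
    MemLp (fun ω => G (U m ω) (U (m + 1) ω) (θ (m + 1) ω)) ⊤ P := by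
  have h1 : ∀ z : State R × State R, ∃ C, ∀ t ∈ Set.Icc (0 : ℝ) 1, ‖G z.1 z.2 t‖ ≤ C := fun z =>
    isCompact_Icc.exists_bound_of_continuousOn (hG z.1 z.2).continuousOn
  choose C hC using h1
  have hmeas : Measurable fun p : (State R × State R) × ℝ => G p.1.1 p.1.2 p.2 :=
    measurable_from_prod_countable_right fun z => (hG z.1 z.2).measurable
  refine memLp_top_of_bound (C := ∑ z, |C z|) (hmeas.comp
    (((hX.measurable_U m).prodMk (hX.measurable_U (m + 1))).prodMk
      (hX.measurable_θ (m + 1) (by omega)))).aestronglyMeasurable ?_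
  filter_upwards [hX.ae_θ_mem hη] with ω hω
  exact ((hC (U m ω, U (m + 1) ω) _ (hω m)).trans (le_abs_self _)).trans
    (Finset.single_le_sum (f := fun z => |C z|) (fun _ _ => abs_nonneg _)
      (Finset.mem_univ (U m ω, U (m + 1) ω)))

theorem integrable_of_memLp_top {X : Ω → ℝ} (hX : MemLp X ⊤ P) : Integrable X P :=
  hX.integrable le_top

/-- By `setIntegral_step`, `stepMean R η G` at `U m` is the conditional expectation of the step
given the past, and the past-measurable factor `W` can be pulled out. -/
theorem IsProcess.integral_mul_step (hX : IsProcess R η P U θ) (hη : η ∈ Set.Icc (0 : ℝ) 1)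
    {m : ℕ} {W : Ω → ℝ} (hW : StronglyMeasurable[past U θ m] W) (hWb : MemLp W ⊤ P)
    {G : State R → State R → ℝ → ℝ} (hG : ∀ i j, Continuous (G i j)) :
    ∫ ω, W ω * G (U m ω) (U (m + 1) ω) (θ (m + 1) ω) ∂P =
      ∫ ω, W ω * stepMean R η G (U m ω) ∂P := by
  have hm := hX.past_le m
  have hGb := hX.memLp_step hη m hG
  set F : Ω → ℝ := fun ω => G (U m ω) (U (m + 1) ω) (θ (m + 1) ω)
  have hF := integrable_of_memLp_top hGb
  have h1 : (fun ω => stepMean R η G (U m ω)) =ᵐ[P] P[F | past U θ m] :=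
    ae_eq_condExp_of_forall_setIntegral_eq hm hF
      (fun s _ _ => (integrable_of_memLp_top (hX.memLp_comp _ m)).integrableOn)
      (fun s hs _ => hX.setIntegral_step hη m (fun i j => (hG i j).measurable) hF hs)
      ((measurable_of_finite (stepMean R η G)).comp
        (measurable_U_past le_rfl)).stronglyMeasurable.aestronglyMeasurable
  have h2 := condExp_mul_of_stronglyMeasurable_left (f := W) (g := F) hW
    (integrable_of_memLp_top (memLp_top_mul hWb hGb)) hF
  calc ∫ ω, W ω * F ω ∂P = ∫ ω, (P[W * F | past U θ m]) ω ∂P := (integral_condExp hm).symm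
    _ = ∫ ω, W ω * stepMean R η G (U m ω) ∂P := by
      refine integral_congr_ae ?_
      filter_upwards [h1, h2] with ω e1 e2
      rw [e2, Pi.mul_apply, ← e1]

theorem IsProcess.integral_step (hX : IsProcess R η P U θ) (hη : η ∈ Set.Icc (0 : ℝ) 1)
    {m : ℕ} {G : State R → State R → ℝ → ℝ} (hG : ∀ i j, Continuous (G i j)) :
    ∫ ω, G (U m ω) (U (m + 1) ω) (θ (m + 1) ω) ∂P = ∫ ω, stepMean R η G (U m ω) ∂P := by
  simpa using hX.integral_mul_step hη (W := fun _ => 1) stronglyMeasurable_const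
    (memLp_top_const 1) hG

theorem IsProcess.covariance_step (hX : IsProcess R η P U θ) (hη : η ∈ Set.Icc (0 : ℝ) 1)
    {m : ℕ} {W : Ω → ℝ} (hW : StronglyMeasurable[past U θ m] W) (hWb : MemLp W ⊤ P)
    {G : State R → State R → ℝ → ℝ} (hG : ∀ i j, Continuous (G i j)) :
    cov[W, fun ω => G (U m ω) (U (m + 1) ω) (θ (m + 1) ω); P] =
      cov[W, fun ω => stepMean R η G (U m ω); P] := by
  rw [covariance_eq_sub (hWb.mono_exponent le_top) ((hX.memLp_step hη m hG).mono_exponent le_top),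
    covariance_eq_sub (hWb.mono_exponent le_top)
      ((hX.memLp_comp (stepMean R η G) m).mono_exponent le_top), hX.integral_step hη hG]
  congr 1
  exact hX.integral_mul_step hη hW hWb hG

end

/-! ### Stopped sums, their martingale part, and variance asymptotics. -/

section

variable {R : ℕ} {η : ℝ} {Ω : Type*} {U : ℕ → Ω → State R} {θ : ℕ → Ω → ℝ}

/-- `τ` is a stopping time of the process, bounded by `N`. -/
structure IsBoundedStopping (U : ℕ → Ω → State R) (θ : ℕ → Ω → ℝ) (τ : Ω → ℕ) (N : ℕ) : Prop where
  le : ∀ ω, τ ω ≤ N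
  measurableSet_lt : ∀ k, MeasurableSet[past U θ k] {ω | k < τ ω}

theorem isBoundedStopping_const (U : ℕ → Ω → State R) (θ : ℕ → Ω → ℝ) (n : ℕ) :
    IsBoundedStopping U θ (fun _ => n) n :=
  ⟨fun _ => le_rfl, fun _ => MeasurableSet.const _⟩

/-- The sum of the functional `G` of the transitions and their durations before time `τ`. -/
def stopSum (U : ℕ → Ω → State R) (θ : ℕ → Ω → ℝ) (G : State R → State R → ℝ → ℝ) (τ : Ω → ℕ)
    (ω : Ω) : ℝ :=
  ∑ k ∈ Finset.range (τ ω), G (U k ω) (U (k + 1) ω) (θ (k + 1) ω)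

/-- The indicator of the event that step `k` is made before time `τ`. -/
def stopInd (τ : Ω → ℕ) (k : ℕ) (ω : Ω) : ℝ := if k < τ ω then 1 else 0

/-- This trades a random range for a fixed one. For a stopping time the weights are predictable,
that is, known before the step is made. -/
theorem sum_range_stop {τ : Ω → ℕ} {N : ℕ} {ω : Ω} (h : τ ω ≤ N) (f : ℕ → ℝ) :
    ∑ k ∈ Finset.range (τ ω), f k = ∑ k ∈ Finset.range N, stopInd τ k ω * f k := by
  simp only [stopInd, ite_mul, one_mul, zero_mul, ← Finset.sum_filter]
  refine Finset.sum_congr ?_ fun _ _ => rfl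
  ext k
  simp only [Finset.mem_range, Finset.mem_filter]
  omega

theorem IsBoundedStopping.stronglyMeasurable_stopInd {τ : Ω → ℕ} {N : ℕ}
    (hτ : IsBoundedStopping U θ τ N) (k : ℕ) : StronglyMeasurable[past U θ k] (stopInd τ k) :=
  (Measurable.ite (hτ.measurableSet_lt k) measurable_const measurable_const).stronglyMeasurable

theorem stronglyMeasurable_step_past {G : State R → State R → ℝ → ℝ}
    (hG : ∀ i j, Continuous (G i j)) {m n : ℕ} (h : m < n) :
    StronglyMeasurable[past U θ n] fun ω => G (U m ω) (U (m + 1) ω) (θ (m + 1) ω) := by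
  have hmeas : Measurable fun p : (State R × State R) × ℝ => G p.1.1 p.1.2 p.2 :=
    measurable_from_prod_countable_right fun z => (hG z.1 z.2).measurable
  exact (hmeas.comp (((measurable_U_past h.le).prodMk (measurable_U_past h)).prodMk
    (measurable_θ_past (by omega) h))).stronglyMeasurable

variable [mΩ : MeasurableSpace Ω] {P : Measure Ω} {τ : Ω → ℕ} {N : ℕ}

theorem IsProcess.memLp_stopInd (hX : IsProcess R η P U θ) (hτ : IsBoundedStopping U θ τ N)
    (k : ℕ) : MemLp (stopInd τ k) ⊤ P := by
  refine memLp_top_of_bound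
    ((hτ.stronglyMeasurable_stopInd k).mono (hX.past_le k)).aestronglyMeasurable 1
    (ae_of_all _ fun ω => ?_)
  unfold stopInd
  split_ifs <;> simp

variable [IsProbabilityMeasure P]

theorem IsProcess.memLp_stopSum (hX : IsProcess R η P U θ) (hη : η ∈ Set.Icc (0 : ℝ) 1)
    (hτ : IsBoundedStopping U θ τ N) {G : State R → State R → ℝ → ℝ}
    (hG : ∀ i j, Continuous (G i j)) : MemLp (stopSum U θ G τ) ⊤ P := by
  have : stopSum U θ G τ = fun ω => ∑ k ∈ Finset.range N,
      stopInd τ k ω * G (U k ω) (U (k + 1) ω) (θ (k + 1) ω) :=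
    funext fun ω => sum_range_stop (hτ.le ω) _
  rw [this]
  exact memLp_finsetSum _ fun k _ => memLp_top_mul (hX.memLp_stopInd hτ k) (hX.memLp_step hη k hG)

theorem IsProcess.integral_stopSum (hX : IsProcess R η P U θ) (hη : η ∈ Set.Icc (0 : ℝ) 1)
    (hτ : IsBoundedStopping U θ τ N) {G : State R → State R → ℝ → ℝ}
    (hG : ∀ i j, Continuous (G i j)) :
    ∫ ω, stopSum U θ G τ ω ∂P =
      ∫ ω, stopSum U θ (fun i _ _ => stepMean R η G i) τ ω ∂P := by
  simp only [stopSum, sum_range_stop (hτ.le _)]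
  rw [integral_finsetSum, integral_finsetSum]
  · exact Finset.sum_congr rfl fun k _ => hX.integral_mul_step hη (hτ.stronglyMeasurable_stopInd k)
      (hX.memLp_stopInd hτ k) hG
  · exact fun k _ => integrable_of_memLp_top
      (memLp_top_mul (hX.memLp_stopInd hτ k) (hX.memLp_comp _ k))
  · exact fun k _ => integrable_of_memLp_top
      (memLp_top_mul (hX.memLp_stopInd hτ k) (hX.memLp_step hη k hG))

/-- The second moment of a stopped martingale is the mean of its stopped bracket. -/
theorem IsProcess.integral_stopSum_sq (hX : IsProcess R η P U θ) (hη : η ∈ Set.Icc (0 : ℝ) 1)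
    (hτ : IsBoundedStopping U θ τ N) {G : State R → State R → ℝ → ℝ}
    (hG : ∀ i j, Continuous (G i j)) (hG0 : ∀ i, stepMean R η G i = 0) :
    ∫ ω, stopSum U θ G τ ω ^ 2 ∂P =
      ∫ ω, stopSum U θ (fun i j t => G i j t ^ 2) τ ω ∂P := by
  have hG2 : ∀ i j, Continuous fun t => G i j t ^ 2 := fun i j => (hG i j).pow 2
  set D : ℕ → Ω → ℝ := fun k ω => G (U k ω) (U (k + 1) ω) (θ (k + 1) ω) with hD
  have hI := hX.memLp_stopInd hτ
  have hDb : ∀ k, MemLp (D k) ⊤ P := fun k => hX.memLp_step hη k hG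
  have hsm : ∀ n, StronglyMeasurable[past U θ n]
      fun ω => ∑ k ∈ Finset.range n, stopInd τ k ω * D k ω := fun n =>
    Finset.stronglyMeasurable_fun_sum _ fun k hk =>
      ((hτ.stronglyMeasurable_stopInd k).mono (past_mono (Finset.mem_range.1 hk).le)).mul
        (stronglyMeasurable_step_past hG (Finset.mem_range.1 hk))
  have hMb : ∀ n, MemLp (fun ω => ∑ k ∈ Finset.range n, stopInd τ k ω * D k ω) ⊤ P := fun n =>
    memLp_finsetSum _ fun k _ => memLp_top_mul (hI k) (hDb k)
  have hDsq : ∀ k, MemLp (fun ω => stopInd τ k ω * D k ω ^ 2) ⊤ P := fun k =>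
    memLp_top_mul (hI k) (hX.memLp_step hη k hG2)
  have key : ∀ n, ∫ ω, (∑ k ∈ Finset.range n, stopInd τ k ω * D k ω) ^ 2 ∂P =
      ∫ ω, ∑ k ∈ Finset.range n, stopInd τ k ω * D k ω ^ 2 ∂P := by
    intro n
    induction n with
    | zero => simp
    | succ n ih =>
      have e : ∀ ω, (∑ k ∈ Finset.range (n + 1), stopInd τ k ω * D k ω) ^ 2 =
          (∑ k ∈ Finset.range n, stopInd τ k ω * D k ω) ^ 2 +
          ((2 * (∑ k ∈ Finset.range n, stopInd τ k ω * D k ω) * stopInd τ n ω) * D n ω +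
            stopInd τ n ω * D n ω ^ 2) := by
        intro ω
        rw [Finset.sum_range_succ]
        have : stopInd τ n ω ^ 2 = stopInd τ n ω := by unfold stopInd; split_ifs <;> simp
        linear_combination D n ω ^ 2 * this
      have hWb : MemLp (fun ω => 2 * (∑ k ∈ Finset.range n, stopInd τ k ω * D k ω) *
          stopInd τ n ω) ⊤ P := memLp_top_mul ((hMb n).const_mul 2) (hI n)
      -- Martingale increments are orthogonal to the past: the factor of `D n` is measurable before
      -- step `n`, and the conditional mean of `D n` is zero.
      have h0 : ∫ ω, (2 * (∑ k ∈ Finset.range n, stopInd τ k ω * D k ω) * stopInd τ n ω) * D n ω ∂P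
          = 0 := by
        have := hX.integral_mul_step hη (((hsm n).const_mul 2).mul (hτ.stronglyMeasurable_stopInd n))
          hWb hG
        simpa [hG0] using this
      have hM2 : MemLp (fun ω => (∑ k ∈ Finset.range n, stopInd τ k ω * D k ω) ^ 2) ⊤ P := by
        simpa only [sq] using memLp_top_mul (hMb n) (hMb n)
      simp only [e]
      rw [integral_add (g := fun ω => (2 * (∑ k ∈ Finset.range n, stopInd τ k ω * D k ω) *
          stopInd τ n ω) * D n ω + stopInd τ n ω * D n ω ^ 2) (integrable_of_memLp_top hM2)
          (integrable_of_memLp_top ((memLp_top_mul hWb (hDb n)).add (hDsq n))),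
        integral_add (integrable_of_memLp_top (memLp_top_mul hWb (hDb n)))
          (integrable_of_memLp_top (hDsq n)), h0, ih, zero_add]
      simp only [Finset.sum_range_succ]
      rw [integral_add (integrable_of_memLp_top (memLp_finsetSum _ fun k _ => hDsq k))
        (integrable_of_memLp_top (hDsq n))]
  simp only [stopSum, sum_range_stop (hτ.le _)]
  exact key N

/-- Occupation sums before a stopping time `τ` are, up to a bounded error, `E[τ]` times the
stationary mean. -/
theorem IsProcess.abs_integral_occupation_sub_le (hX : IsProcess R η P U θ)
    (hη : η ∈ Set.Icc (0 : ℝ) 1) (hR : 1 ≤ R) (hτ : IsBoundedStopping U θ τ N)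
    (h : State R → ℝ) :
    |∫ ω, stopSum U θ (fun i _ _ => h i) τ ω ∂P - (steady R ⬝ᵥ h) * ∫ ω, (τ ω : ℝ) ∂P| ≤
      2 * ∑ i, |poisson R h i| := by
  set χ := poisson R h with hχ
  have hint : ∀ {G : State R → State R → ℝ → ℝ}, (∀ i j, Continuous (G i j)) →
      Integrable (stopSum U θ G τ) P := fun hG =>
    integrable_of_memLp_top (hX.memLp_stopSum hη hτ hG)
  have e0 : ∀ ω, stopSum U θ (fun _ _ _ => steady R ⬝ᵥ h) τ ω = (steady R ⬝ᵥ h) * (τ ω : ℝ) := by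
    intro ω
    simp [stopSum, mul_comm]
  -- By the Poisson equation, the centred `h` at `i` is `χ i - χ j`, which telescopes along the
  -- path, plus `χ j - (P χ) i`, which has conditional mean zero.
  have e1 : ∀ ω, stopSum U θ (fun i _ _ => h i) τ ω - (steady R ⬝ᵥ h) * (τ ω : ℝ) =
      stopSum U θ (fun i j _ => χ i - χ j) τ ω +
        stopSum U θ (fun i j _ => χ j - (transMatrix R *ᵥ χ) i) τ ω := by
    intro ω
    rw [← e0]
    simp only [stopSum, ← Finset.sum_sub_distrib, ← Finset.sum_add_distrib]
    refine Finset.sum_congr rfl fun k _ => ?_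
    have := poisson_sub_mulVec hR h (U k ω)
    rw [← hχ] at this
    linarith
  have h0 : ∫ ω, stopSum U θ (fun i j _ => χ j - (transMatrix R *ᵥ χ) i) τ ω ∂P = 0 := by
    rw [hX.integral_stopSum hη hτ (fun _ _ => continuous_const)]
    have : ∀ i, stepMean R η (fun i j _ => χ j - (transMatrix R *ᵥ χ) i) i = 0 := by
      intro i
      simp [stepMean, mul_sub, Finset.sum_sub_distrib, ← Finset.sum_mul, transMatrix_row_sum,
        Matrix.mulVec, dotProduct, -Finset.univ_eq_attach]
    simp [this, stopSum]
  have e2 : ∀ ω, stopSum U θ (fun i j _ => χ i - χ j) τ ω = χ (U 0 ω) - χ (U (τ ω) ω) := fun ω =>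
    Finset.sum_range_sub' (fun k => χ (U k ω)) (τ ω)
  have hbd : ∀ i, |χ i| ≤ ∑ i, |χ i| := fun i =>
    Finset.single_le_sum (f := fun i => |χ i|) (fun _ _ => abs_nonneg _) (Finset.mem_univ i)
  rw [← integral_const_mul, ← integral_sub (hint fun _ _ => continuous_const)
    ((integrable_congr (ae_of_all _ e0)).1 (hint fun _ _ => continuous_const)),
    integral_congr_ae (ae_of_all _ e1), integral_add (hint fun _ _ => continuous_const)
    (hint fun _ _ => continuous_const), h0, add_zero]
  have := norm_integral_le_of_norm_le_const (μ := P) (C := 2 * ∑ i, |χ i|)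
    (f := stopSum U θ (fun i j _ => χ i - χ j) τ) (ae_of_all _ fun ω => by
      rw [e2, Real.norm_eq_abs]
      have := abs_sub (χ (U 0 ω)) (χ (U (τ ω) ω))
      linarith [hbd (U 0 ω), hbd (U (τ ω) ω)])
  simpa using this

theorem tendsto_div_nat_of_abs_sub_le {a b : ℕ → ℝ} {C x : ℝ} (h : ∀ n, |a n - b n| ≤ C)
    (hb : Tendsto (fun n => b n / n) atTop (𝓝 x)) : Tendsto (fun n => a n / n) atTop (𝓝 x) := by
  have h0 : Tendsto (fun n : ℕ => a n / n - b n / n) atTop (𝓝 0) := by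
    refine squeeze_zero_norm (fun n => ?_) (tendsto_const_div_atTop_nhds_zero_nat C)
    rw [← sub_div, norm_div, Real.norm_eq_abs, Real.norm_natCast]
    exact div_le_div_of_nonneg_right (h n) (Nat.cast_nonneg n)
  simpa using h0.add hb

/-- A bounded perturbation changes the variance by at most a multiple of the standard deviation. -/
theorem abs_variance_sub_le {M Y : Ω → ℝ} {d K : ℝ} (hM : MemLp M ⊤ P) (hM0 : ∫ ω, M ω ∂P = 0)
    (hY : AEStronglyMeasurable Y P) (hK : ∀ᵐ ω ∂P, |Y ω - M ω - d| ≤ K) :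
    |Var[Y; P] - ∫ ω, M ω ^ 2 ∂P| ≤ 2 * K * √(∫ ω, M ω ^ 2 ∂P) + K ^ 2 := by
  have hK0 : 0 ≤ K := by
    obtain ⟨ω, hω⟩ := hK.exists
    exact (abs_nonneg _).trans hω
  set B : Ω → ℝ := fun ω => Y ω - M ω - d with hB
  have hBm : AEStronglyMeasurable B P :=
    (hY.sub hM.aestronglyMeasurable).sub aestronglyMeasurable_const
  have hBb : MemLp B ⊤ P := memLp_top_of_bound hBm K hK
  have h2 : ∀ {X : Ω → ℝ}, MemLp X ⊤ P → MemLp X 2 P := fun h => h.mono_exponent le_top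
  have hYe : Y = fun ω => (M ω + B ω) + d := by
    ext ω
    simp only [hB]
    ring
  have hvar : Var[Y; P] = Var[M; P] + 2 * cov[M, B; P] + Var[B; P] := by
    rw [hYe, variance_add_const (X := fun ω => M ω + B ω) (hM.add hBb).aestronglyMeasurable,
      variance_fun_add (h2 hM) (h2 hBb)]
  have hVM : Var[M; P] = ∫ ω, M ω ^ 2 ∂P :=
    variance_of_integral_eq_zero hM.aestronglyMeasurable.aemeasurable hM0
  have hVB : Var[B; P] ≤ K ^ 2 := by
    refine (variance_le_expectation_sq hBm).trans ?_
    have := norm_integral_le_of_norm_le_const (μ := P) (C := K ^ 2) (f := B ^ 2) (by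
      filter_upwards [hK] with ω hω
      rw [Pi.pow_apply, norm_pow]
      exact pow_le_pow_left₀ (norm_nonneg _) hω 2)
    simp only [probReal_univ, mul_one] at this
    exact (le_abs_self _).trans this
  have hcov : |cov[M, B; P]| ≤ K * √(∫ ω, M ω ^ 2 ∂P) := by
    rw [covariance_eq_sub (h2 hM) (h2 hBb), hM0, zero_mul, sub_zero]
    have hMabs : MemLp (fun ω => |M ω|) ⊤ P := hM.abs
    -- Cauchy–Schwarz, in the form that the variance of `|M|` is nonnegative.
    have h3 : ∫ ω, |M ω| ∂P ≤ √(∫ ω, M ω ^ 2 ∂P) := by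
      refine Real.le_sqrt_of_sq_le ?_
      have := variance_nonneg (fun ω => |M ω|) P
      rw [variance_eq_sub (h2 hMabs)] at this
      simpa [sq_abs] using this
    calc |∫ ω, (M * B) ω ∂P| ≤ ∫ ω, |(M * B) ω| ∂P := abs_integral_le_integral_abs
      _ ≤ ∫ ω, K * |M ω| ∂P := by
        refine integral_mono_ae (integrable_of_memLp_top (memLp_top_mul hM hBb)).abs
          ((integrable_of_memLp_top hMabs).const_mul K) ?_
        filter_upwards [hK] with ω hω
        rw [Pi.mul_apply, abs_mul, mul_comm]
        exact mul_le_mul_of_nonneg_right hω (abs_nonneg _)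
      _ = K * ∫ ω, |M ω| ∂P := integral_const_mul _ _
      _ ≤ _ := mul_le_mul_of_nonneg_left h3 hK0
  have hVB0 := variance_nonneg B P
  rw [hvar, hVM, abs_le]
  constructor <;> linarith [(abs_le.1 hcov).1, (abs_le.1 hcov).2]

/-- The bracket of the stopped martingale is itself an occupation sum, hence its mean is linear in
the mean of the stopping time up to `O(1)`. The perturbation costs a multiple of the standard
deviation, which is `o(n)`. -/
theorem IsProcess.tendsto_variance_div (hX : IsProcess R η P U θ) (hη : η ∈ Set.Icc (0 : ℝ) 1)
    (hR : 1 ≤ R) {τ : ℕ → Ω → ℕ} {N : ℕ → ℕ} (hτ : ∀ n, IsBoundedStopping U θ (τ n) (N n)) {ρ : ℝ}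
    (hρ : Tendsto (fun n : ℕ => (∫ ω, (τ n ω : ℝ) ∂P) / n) atTop (𝓝 ρ))
    {G : State R → State R → ℝ → ℝ} (hG : ∀ i j, Continuous (G i j))
    (hG0 : ∀ i, stepMean R η G i = 0) {Y : ℕ → Ω → ℝ} (hY : ∀ n, AEStronglyMeasurable (Y n) P)
    {d : ℕ → ℝ} {K : ℝ} (hK : ∀ n, ∀ᵐ ω ∂P, |Y n ω - stopSum U θ G (τ n) ω - d n| ≤ K) :
    Tendsto (fun n : ℕ => Var[Y n; P] / n) atTop
      (𝓝 ((steady R ⬝ᵥ stepMean R η fun i j t => G i j t ^ 2) * ρ)) := by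
  have hG2 : ∀ i j, Continuous fun t => G i j t ^ 2 := fun i j => (hG i j).pow 2
  set M : ℕ → Ω → ℝ := fun n => stopSum U θ G (τ n) with hM
  set v := stepMean R η fun i j t => G i j t ^ 2 with hv
  have hM2 : Tendsto (fun n : ℕ => (∫ ω, M n ω ^ 2 ∂P) / n) atTop (𝓝 ((steady R ⬝ᵥ v) * ρ)) := by
    refine tendsto_div_nat_of_abs_sub_le
      (b := fun n => (steady R ⬝ᵥ v) * ∫ ω, (τ n ω : ℝ) ∂P) (C := 2 * ∑ i, |poisson R v i|)
      (fun n => ?_) ?_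
    · rw [hM, hX.integral_stopSum_sq hη (hτ n) hG hG0, hX.integral_stopSum hη (hτ n) hG2]
      exact hX.abs_integral_occupation_sub_le hη hR (hτ n) v
    · simpa only [mul_div_assoc] using hρ.const_mul (steady R ⬝ᵥ v)
  have hM0 : ∀ n, ∫ ω, M n ω ∂P = 0 := by
    intro n
    rw [hM, hX.integral_stopSum hη (hτ n) hG]
    simp [hG0, stopSum]
  have hdiff := fun n => abs_variance_sub_le (hX.memLp_stopSum hη (hτ n) hG) (hM0 n) (hY n) (hK n)
  have hsqrt : Tendsto (fun n : ℕ => √(∫ ω, M n ω ^ 2 ∂P) / n) atTop (𝓝 0) := by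
    have h1 := (hM2.mul tendsto_one_div_atTop_nhds_zero_nat).sqrt
    rw [mul_zero, Real.sqrt_zero] at h1
    refine h1.congr fun n => ?_
    rw [div_mul_div_comm, mul_one, Real.sqrt_div' _ (by positivity),
      Real.sqrt_mul_self (Nat.cast_nonneg n)]
  have h0 : Tendsto (fun n : ℕ => Var[Y n; P] / n - (∫ ω, M n ω ^ 2 ∂P) / n) atTop (𝓝 0) := by
    have hb : Tendsto (fun n : ℕ => 2 * K * (√(∫ ω, M n ω ^ 2 ∂P) / n) + K ^ 2 / n) atTop (𝓝 0) := by
      simpa using (hsqrt.const_mul (2 * K)).add (tendsto_const_div_atTop_nhds_zero_nat (K ^ 2))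
    refine squeeze_zero_norm (fun n => ?_) hb
    rw [← sub_div, norm_div, Real.norm_eq_abs, Real.norm_natCast, ← mul_div_assoc, ← add_div]
    exact div_le_div_of_nonneg_right (hdiff n) (Nat.cast_nonneg n)
  simpa using h0.add hM2

end

/-! ### The asymptotic variance of `a * U + b * θ` as a quadratic form in `(a, b)`. -/

section

variable {R : ℕ} {η : ℝ}

/-- The second moment of an inter-transmission time, given that `i` nodes have been updated. -/
def sqTime {R : ℕ} (η : ℝ) (i : State R) : ℝ := ∫ t, t ^ 2 ∂timeLaw η i

theorem integral_timeLaw_affine (hη : η ∈ Set.Icc (0 : ℝ) 1) (i : State R) (c b : ℝ) :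
    ∫ t, (c + b * t) ∂timeLaw η i = c + b * meanTime η i := by
  rw [integral_add (integrable_const c)
    (((memLp_timeLaw_id hη i 1).integrable le_rfl).const_mul b), integral_const_mul,
    integral_timeLaw_id]
  simp

theorem integral_timeLaw_affine_sq (hη : η ∈ Set.Icc (0 : ℝ) 1) (i : State R) (c b : ℝ) :
    ∫ t, (c + b * t) ^ 2 ∂timeLaw η i =
      c ^ 2 + 2 * c * b * meanTime η i + b ^ 2 * sqTime η i := by
  have h1 := (memLp_timeLaw_id hη (i : ℕ) 1).integrable le_rfl
  have h2 := (memLp_timeLaw_id hη (i : ℕ) 2).integrable_sq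
  have e : ∀ t : ℝ, (c + b * t) ^ 2 = (c ^ 2 + (2 * c * b) * t) + b ^ 2 * t ^ 2 := fun t => by ring
  simp only [e]
  rw [integral_add (f := fun t => c ^ 2 + (2 * c * b) * t)
    ((integrable_const _).add (h1.const_mul _)) (h2.const_mul _),
    integral_timeLaw_affine hη, integral_const_mul, sqTime]

theorem stepMean_state (h : State R → ℝ) :
    stepMean R η (fun _ j _ => h j) = transMatrix R *ᵥ h := by
  ext i
  simp [stepMean, Matrix.mulVec, dotProduct]

theorem stepMean_time (c : State R → State R → ℝ) :
    stepMean R η (fun i j t => c i j * t) =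
      fun i => meanTime η i * (transMatrix R *ᵥ c i) i := by
  ext i
  have h : ∀ j, ∫ t, c i j * t ∂timeLaw η i = c i j * meanTime η i := fun j => by
    rw [integral_const_mul, integral_timeLaw_id]
  simp only [stepMean, h, Matrix.mulVec, dotProduct, Finset.mul_sum]
  exact Finset.sum_congr rfl fun j _ => by ring

theorem stepMean_time_self : stepMean R η (fun _ _ t => t) = meanTime η := by
  have := stepMean_time (R := R) (η := η) fun _ _ => 1
  simp only [one_mul] at this
  rw [this]
  ext i
  rw [transMatrix_mulVec_const, mul_one]

/-- The real-valued identity on the states. -/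
def stateVal (R : ℕ) : State R → ℝ := fun j => ((j : ℕ) : ℝ)

theorem steady_dotProduct_stateVal : steady R ⬝ᵥ stateVal R = muU R := muU_eq_dotProduct.symm

theorem steady_dotProduct_meanTime : steady R ⬝ᵥ meanTime η = muTheta R η := rfl

/-- The corrector of the additive functional `a * U + b * θ`. -/
def corrector (R : ℕ) (η a b : ℝ) : State R → ℝ :=
  fun i => a * poisson R (stateVal R) i + b * poisson R (meanTime η) i

/-- The martingale increments of the centred additive functional `a * U + b * θ`. -/
def incr (R : ℕ) (η a b : ℝ) (i j : State R) (t : ℝ) : ℝ :=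
  a * (((i : ℕ) : ℝ) - muU R) + b * (t - muTheta R η) + (corrector R η a b j - corrector R η a b i)

theorem continuous_incr (a b : ℝ) (i j : State R) : Continuous (incr R η a b i j) := by
  unfold incr
  fun_prop

theorem corrector_sub_mulVec (hR : 1 ≤ R) (a b : ℝ) (i : State R) :
    corrector R η a b i - (transMatrix R *ᵥ corrector R η a b) i =
      a * (((i : ℕ) : ℝ) - muU R) + b * (meanTime η i - muTheta R η) := by
  have e : corrector R η a b = a • poisson R (stateVal R) + b • poisson R (meanTime η) := rfl
  have h1 := poisson_sub_mulVec hR (stateVal R) i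
  have h2 := poisson_sub_mulVec hR (meanTime η) i
  rw [steady_dotProduct_stateVal, stateVal] at h1
  rw [steady_dotProduct_meanTime] at h2
  rw [e, Matrix.mulVec_add, Matrix.mulVec_smul, Matrix.mulVec_smul]
  simp only [Pi.add_apply, Pi.smul_apply, smul_eq_mul]
  linear_combination a * h1 + b * h2

theorem incr_eq (a b : ℝ) (i j : State R) (t : ℝ) :
    incr R η a b i j t = (a * (((i : ℕ) : ℝ) - muU R) - b * muTheta R η - corrector R η a b i +
      corrector R η a b j) + b * t := by
  unfold incr
  ring

theorem stepMean_incr (hη : η ∈ Set.Icc (0 : ℝ) 1) (hR : 1 ≤ R) (a b : ℝ) (i : State R) :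
    stepMean R η (incr R η a b) i = 0 := by
  have h := corrector_sub_mulVec (η := η) hR a b i
  simp only [stepMean, incr_eq, integral_timeLaw_affine hη, mul_add, Finset.sum_add_distrib,
    ← Finset.sum_mul, transMatrix_row_sum, one_mul]
  simp only [Matrix.mulVec, dotProduct] at h
  linear_combination -h

/-- Given the present state, duration and next state are independent, so the conditional variance is
that of `b * θ` plus that of the corrector at the next state. -/
theorem stepMean_incr_sq (hη : η ∈ Set.Icc (0 : ℝ) 1) (hR : 1 ≤ R) (a b : ℝ) (i : State R) :
    stepMean R η (fun i j t => incr R η a b i j t ^ 2) i =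
      b ^ 2 * (sqTime η i - meanTime η i ^ 2) +
        (transMatrix R *ᵥ (corrector R η a b * corrector R η a b)) i -
          (transMatrix R *ᵥ corrector R η a b) i ^ 2 := by
  have h := corrector_sub_mulVec (η := η) hR a b i
  simp only [stepMean, incr_eq, integral_timeLaw_affine_sq hη]
  set ψ := corrector R η a b
  set e := a * (((i : ℕ) : ℝ) - muU R) - b * muTheta R η - ψ i with he
  have h1 : ∀ j, transMatrix R i j * ((e + ψ j) ^ 2 + 2 * (e + ψ j) * b * meanTime η i +
      b ^ 2 * sqTime η i) = (e ^ 2 + 2 * e * b * meanTime η i + b ^ 2 * sqTime η i) *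
        transMatrix R i j + (2 * e + 2 * b * meanTime η i) * (transMatrix R i j * ψ j) +
          transMatrix R i j * (ψ * ψ) j := by
    intro j
    rw [Pi.mul_apply]
    ring
  have h2 : (transMatrix R *ᵥ ψ) i = -(e + b * meanTime η i) := by linarith
  simp only [h1, Finset.sum_add_distrib, ← Finset.mul_sum, transMatrix_row_sum]
  change _ + (2 * e + 2 * b * meanTime η i) * (transMatrix R *ᵥ ψ) i +
    (transMatrix R *ᵥ (ψ * ψ)) i = _
  rw [h2]
  ring

/-- The asymptotic variance of the additive functional `a * U + b * θ`. -/
def asympVar (R : ℕ) (η a b : ℝ) : ℝ :=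
  steady R ⬝ᵥ stepMean R η fun i j t => incr R η a b i j t ^ 2

/-- On an eigenvector with eigenvalue `-1/2`, the Poisson equation is solved by the factor `1 / (1 +
1/2)`. -/
theorem poisson_stateVal (hR : 1 ≤ R) :
    poisson R (stateVal R) = fun i : State R => 2 / 3 * (((i : ℕ) : ℝ) - muU R) := by
  have h0 : steady R ⬝ᵥ (fun i : State R => ((i : ℕ) : ℝ) - muU R) = 0 := by
    have := steady_dotProduct_centered hR (stateVal R)
    rwa [steady_dotProduct_stateVal] at this
  have h1 : fundamentalInv R *ᵥ ((2 / 3 : ℝ) • fun i : State R => ((i : ℕ) : ℝ) - muU R) =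
      fun i => stateVal R i - steady R ⬝ᵥ stateVal R := by
    ext i
    rw [fundamentalInv_mulVec, Matrix.mulVec_smul, dotProduct_smul, h0,
      steady_dotProduct_stateVal]
    simp only [Pi.smul_apply, mulVec_num_centered hR, smul_eq_mul, stateVal]
    ring
  rw [poisson, ← h1, fundamental_mulVec_fundamentalInv hR]
  rfl

theorem steady_dotProduct_stateVal_mul_poisson (hR : 1 ≤ R) (h : State R → ℝ) :
    steady R ⬝ᵥ ((fun j : State R => ((j : ℕ) : ℝ) - muU R) * poisson R h) =
      2 / 3 * (steady R ⬝ᵥ ((fun j : State R => ((j : ℕ) : ℝ) - muU R) *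
        fun i => h i - steady R ⬝ᵥ h)) := by
  have h1 := steady_dotProduct_num_mul_mulVec hR (poisson R h)
  have h2 : (fun i => h i - steady R ⬝ᵥ h) = poisson R h - transMatrix R *ᵥ poisson R h :=
    funext fun i => (poisson_sub_mulVec hR h i).symm
  rw [h2, mul_sub, dotProduct_sub, h1]
  ring

theorem asympVar_eq (hη : η ∈ Set.Icc (0 : ℝ) 1) (hR : 1 ≤ R) (a b : ℝ) :
    asympVar R η a b =
      a ^ 2 * (1 / 3 * (steady R ⬝ᵥ (stateVal R * stateVal R) - muU R ^ 2)) +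
      b ^ 2 * (steady R ⬝ᵥ sqTime η - 2 * (steady R ⬝ᵥ (meanTime η * meanTime η)) +
        2 * (steady R ⬝ᵥ (meanTime η * poisson R (meanTime η))) + muTheta R η ^ 2) +
      2 * a * b * Delta R η := by
  set F : State R → ℝ := fun j => ((j : ℕ) : ℝ) - muU R with hF
  set Γ : State R → ℝ := fun j => meanTime η j - muTheta R η with hΓ
  set ψ := poisson R (meanTime (R := R) η) with hψ
  set C := corrector R η a b with hC
  have hCe : C = (2 / 3 * a) • F + b • ψ := by
    ext i
    simp only [hC, corrector, poisson_stateVal hR, Pi.add_apply, Pi.smul_apply, smul_eq_mul, hF]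
    ring
  have hφ : transMatrix R *ᵥ C = C - (a • F + b • Γ) := by
    ext i
    have := corrector_sub_mulVec (η := η) hR a b i
    simp only [Pi.sub_apply, Pi.add_apply, Pi.smul_apply, smul_eq_mul, hF, hΓ]
    linarith
  have h1 : (stepMean R η fun i j t => incr R η a b i j t ^ 2) =
      (b ^ 2 : ℝ) • (sqTime η - meanTime η * meanTime η) + transMatrix R *ᵥ (C * C) -
        (transMatrix R *ᵥ C) * (transMatrix R *ᵥ C) := by
    ext i
    rw [stepMean_incr_sq hη hR]
    simp only [Pi.sub_apply, Pi.add_apply, Pi.smul_apply, smul_eq_mul, Pi.mul_apply]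
    ring
  -- By stationarity `P (C * C)` and `C * C` have the same mean, so only this difference matters.
  -- With `hFψ` the cross coefficient of the mean of `F * Γ` becomes `4/3 + 4/3 - 2 = 2/3`, which
  -- gives `2 * a * b * Δ`.
  have h2 : C * C - (C - (a • F + b • Γ)) * (C - (a • F + b • Γ)) =
      (a ^ 2 / 3) • (F * F) + (2 * a * b) • (F * ψ) + (a * b * (4 / 3) - 2 * a * b) • (F * Γ) +
        (2 * b ^ 2) • (Γ * ψ) - (b ^ 2) • (Γ * Γ) := by
    rw [hCe]
    ext i
    simp only [Pi.sub_apply, Pi.add_apply, Pi.smul_apply, smul_eq_mul, Pi.mul_apply]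
    ring
  have hFΓ' : steady R ⬝ᵥ (F * Γ) = steady R ⬝ᵥ (F * meanTime η) := by
    have h3 : F * Γ = F * meanTime η - muTheta R η • F := by
      ext i
      simp only [hΓ, Pi.sub_apply, Pi.smul_apply, smul_eq_mul, Pi.mul_apply]
      ring
    have h4 : steady R ⬝ᵥ F = 0 := by
      have := steady_dotProduct_centered hR (stateVal R)
      rwa [steady_dotProduct_stateVal] at this
    rw [h3, dotProduct_sub, dotProduct_smul, h4, smul_zero, sub_zero]
  have hFψ : steady R ⬝ᵥ (F * ψ) = 2 / 3 * (steady R ⬝ᵥ (F * Γ)) :=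
    steady_dotProduct_stateVal_mul_poisson hR (meanTime η)
  have hΔ : Delta R η = 1 / 3 * (steady R ⬝ᵥ (F * Γ)) := by rw [hFΓ', Delta_eq hR]
  have hFF : steady R ⬝ᵥ (F * F) = steady R ⬝ᵥ (stateVal R * stateVal R) - muU R ^ 2 := by
    have h3 : F * F = stateVal R * stateVal R - (2 * muU R) • stateVal R +
        fun _ => muU R ^ 2 := by
      ext i
      simp only [hF, Pi.sub_apply, Pi.add_apply, Pi.smul_apply, smul_eq_mul, Pi.mul_apply, stateVal]
      ring
    rw [h3, dotProduct_add, dotProduct_sub, dotProduct_smul, steady_dotProduct_stateVal,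
      steady_dotProduct_const hR, smul_eq_mul]
    ring
  have hΓΓ : steady R ⬝ᵥ (Γ * Γ) =
      steady R ⬝ᵥ (meanTime η * meanTime η) - muTheta R η ^ 2 := by
    have h3 : Γ * Γ = meanTime η * meanTime η - (2 * muTheta R η) • meanTime η +
        fun _ => muTheta R η ^ 2 := by
      ext i
      simp only [hΓ, Pi.sub_apply, Pi.add_apply, Pi.smul_apply, smul_eq_mul, Pi.mul_apply]
      ring
    rw [h3, dotProduct_add, dotProduct_sub, dotProduct_smul, steady_dotProduct_meanTime,
      steady_dotProduct_const hR, smul_eq_mul]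
    ring
  have hΓψ : steady R ⬝ᵥ (Γ * ψ) = steady R ⬝ᵥ (meanTime η * ψ) := by
    have h3 : Γ * ψ = meanTime η * ψ - muTheta R η • ψ := by
      ext i
      simp only [hΓ, Pi.sub_apply, Pi.smul_apply, smul_eq_mul, Pi.mul_apply]
      ring
    rw [h3, dotProduct_sub, dotProduct_smul, hψ, steady_dotProduct_poisson hR, smul_zero, sub_zero]
  have h3 : asympVar R η a b =
      b ^ 2 * (steady R ⬝ᵥ sqTime η - steady R ⬝ᵥ (meanTime η * meanTime η)) +
        steady R ⬝ᵥ (C * C - (C - (a • F + b • Γ)) * (C - (a • F + b • Γ))) := by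
    rw [asympVar, h1, hφ, dotProduct_sub, dotProduct_add, steady_dotProduct_mulVec, dotProduct_smul,
      dotProduct_sub, dotProduct_sub, smul_eq_mul]
    ring
  rw [h3, h2]
  simp only [dotProduct_sub, dotProduct_add, dotProduct_smul, smul_eq_mul]
  rw [hFψ, hΓψ, hΔ, hFF, hΓΓ]
  ring

variable {Ω : Type*} {U : ℕ → Ω → State R} {θ : ℕ → Ω → ℝ}

theorem stopSum_incr (a b : ℝ) (τ : Ω → ℕ) (ω : Ω) :
    stopSum U θ (incr R η a b) τ ω =
      a * ∑ k ∈ Finset.range (τ ω), num U k ω + b * time θ (τ ω) ω -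
        τ ω * (a * muU R + b * muTheta R η) +
        (corrector R η a b (U (τ ω) ω) - corrector R η a b (U 0 ω)) := by
  have h1 := Finset.sum_range_sub (fun k => corrector R η a b (U k ω)) (τ ω)
  have h2 : time θ (τ ω) ω = ∑ k ∈ Finset.range (τ ω), θ (k + 1) ω := by
    rw [time, Finset.range_eq_Ico, Finset.sum_Ico_add' (fun k => θ k ω) 0 (τ ω) 1]
    rfl
  rw [← h1, h2]
  simp only [stopSum, incr, Finset.sum_add_distrib, ← Finset.mul_sum, Finset.sum_sub_distrib,
    Finset.sum_const, Finset.card_range, nsmul_eq_mul, num]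
  ring

variable [mΩ : MeasurableSpace Ω] {P : Measure Ω}

theorem IsProcess.aestronglyMeasurable_time (hX : IsProcess R η P U θ) (m : ℕ) :
    AEStronglyMeasurable (time θ m) P :=
  (Finset.measurable_fun_sum _ fun i hi =>
    hX.measurable_θ i (Finset.mem_Icc.1 hi).1).aestronglyMeasurable

theorem IsProcess.aestronglyMeasurable_num (hX : IsProcess R η P U θ) (m : ℕ) :
    AEStronglyMeasurable (num U m) P :=
  ((measurable_of_finite (stateVal R)).comp (hX.measurable_U m)).aestronglyMeasurable

variable [IsProbabilityMeasure P]

/-- The asymptotic variance of an additive functional of the process, stopped at stopping times of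
linearly growing mean, and perturbed by a bounded amount. -/
theorem IsProcess.tendsto_variance_additive (hX : IsProcess R η P U θ)
    (hη : η ∈ Set.Icc (0 : ℝ) 1) (hR : 1 ≤ R) (a b : ℝ) {τ : ℕ → Ω → ℕ} {N : ℕ → ℕ}
    (hτ : ∀ n, IsBoundedStopping U θ (τ n) (N n)) {ρ : ℝ}
    (hρ : Tendsto (fun n : ℕ => (∫ ω, (τ n ω : ℝ) ∂P) / n) atTop (𝓝 ρ))
    {Y : ℕ → Ω → ℝ} (hY : ∀ n, AEStronglyMeasurable (Y n) P) {d : ℕ → ℝ} {K : ℝ}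
    (hK : ∀ n ω, |Y n ω - (a * ∑ k ∈ Finset.range (τ n ω), num U k ω + b * time θ (τ n ω) ω -
      τ n ω * (a * muU R + b * muTheta R η)) - d n| ≤ K) :
    Tendsto (fun n : ℕ => Var[Y n; P] / n) atTop (𝓝 (asympVar R η a b * ρ)) := by
  refine hX.tendsto_variance_div hη hR hτ hρ (continuous_incr a b) (stepMean_incr hη hR a b) hY
    (d := d) (K := K + 2 * ∑ i, |corrector R η a b i|) fun n => ae_of_all _ fun ω => ?_
  have hbd : ∀ i, |corrector R η a b i| ≤ ∑ i, |corrector R η a b i| := fun i =>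
    Finset.single_le_sum (f := fun i => |corrector R η a b i|) (fun _ _ => abs_nonneg _)
      (Finset.mem_univ i)
  have h1 := abs_le.1 (hbd (U (τ n ω) ω))
  have h2 := abs_le.1 (hbd (U 0 ω))
  have h3 := abs_le.1 (hK n ω)
  rw [stopSum_incr, abs_le]
  constructor <;> linarith [h1.1, h1.2, h2.1, h2.2, h3.1, h3.2]

theorem IsProcess.tendsto_variance_linear (hX : IsProcess R η P U θ)
    (hη : η ∈ Set.Icc (0 : ℝ) 1) (hR : 1 ≤ R) (a b : ℝ) :
    Tendsto (fun m : ℕ => Var[fun ω => a * ∑ i ∈ Finset.range (m + 1), num U i ω +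
      b * time θ (m + 1) ω; P] / m) atTop (𝓝 (asympVar R η a b)) := by
  have hρ : Tendsto (fun m : ℕ => (∫ _, ((m + 1 : ℕ) : ℝ) ∂P) / m) atTop (𝓝 1) := by
    simp only [integral_const, probReal_univ, one_smul]
    refine tendsto_div_nat_of_abs_sub_le (b := fun m => m) (C := 1) (fun m => by simp) ?_
    refine tendsto_const_nhds.congr' ?_
    filter_upwards [eventually_gt_atTop 0] with m hm
    rw [div_self (by positivity)]
  have := hX.tendsto_variance_additive hη hR a b
    (fun m => isBoundedStopping_const U θ (m + 1)) hρ
    (Y := fun m ω => a * ∑ i ∈ Finset.range (m + 1), num U i ω + b * time θ (m + 1) ω)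
    (fun m => ((Finset.aestronglyMeasurable_fun_sum _ fun i _ =>
      hX.aestronglyMeasurable_num i).const_mul a).add
        ((hX.aestronglyMeasurable_time (m + 1)).const_mul b))
    -- At a deterministic time the centring is a constant, which the variance ignores.
    (d := fun m => ((m + 1 : ℕ) : ℝ) * (a * muU R + b * muTheta R η)) (K := 0)
    (fun m ω => by
      rw [abs_nonpos_iff]
      ring)
  rwa [mul_one] at this

end

/-! ### The hop count as a stopping time, and the variance of the delay. -/

section

variable {R : ℕ} {η : ℝ} {Ω : Type*} {U : ℕ → Ω → State R} {θ : ℕ → Ω → ℝ}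

/-- Every broadcast updates at least one node. Hence the infimum defining `hopCount` is attained,
and it is at most `n`. -/
theorem le_sum_state (U : ℕ → Ω → State R) (m : ℕ) (ω : Ω) :
    m ≤ ∑ i ∈ Finset.Icc 1 m, (U i ω : ℕ) := by
  calc m = ∑ i ∈ Finset.Icc 1 m, 1 := by simp
    _ ≤ _ := Finset.sum_le_sum fun i _ => one_le_state _

theorem hopCount_le (U : ℕ → Ω → State R) (n : ℕ) (ω : Ω) : hopCount U n ω ≤ n :=
  Nat.sInf_le (le_sum_state U n ω)

theorem le_sum_hopCount (U : ℕ → Ω → State R) (n : ℕ) (ω : Ω) :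
    n ≤ ∑ i ∈ Finset.Icc 1 (hopCount U n ω), (U i ω : ℕ) :=
  Nat.sInf_mem (s := {m : ℕ | n ≤ ∑ i ∈ Finset.Icc 1 m, ((U i ω : State R) : ℕ)})
    ⟨n, le_sum_state U n ω⟩

theorem lt_hopCount_iff (U : ℕ → Ω → State R) (n k : ℕ) (ω : Ω) :
    k < hopCount U n ω ↔ ∑ i ∈ Finset.Icc 1 k, (U i ω : ℕ) < n := by
  constructor
  · intro h
    by_contra! h'
    exact absurd (Nat.sInf_le h' : hopCount U n ω ≤ k) h.not_ge
  · intro h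
    by_contra! h'
    have h1 := Finset.sum_le_sum_of_subset (f := fun i => (U i ω : ℕ))
      (Finset.Icc_subset_Icc_right (a := 1) h')
    have h2 := le_sum_hopCount U n ω
    omega

theorem sum_hopCount_le (U : ℕ → Ω → State R) (n : ℕ) (ω : Ω) :
    ∑ i ∈ Finset.Icc 1 (hopCount U n ω), (U i ω : ℕ) ≤ n + R := by
  rcases h : hopCount U n ω with _ | k
  · simp
  · have h1 := (lt_hopCount_iff U n k ω).1 (by omega)
    have h2 := state_le (U (k + 1) ω)
    rw [Finset.sum_Icc_succ_top (by omega)]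
    omega

theorem isBoundedStopping_hopCount (U : ℕ → Ω → State R) (θ : ℕ → Ω → ℝ) (n : ℕ) :
    IsBoundedStopping U θ (hopCount U n) n := by
  refine ⟨hopCount_le U n, fun k => ?_⟩
  simp only [lt_hopCount_iff]
  have : Measurable[past U θ k] fun ω => ∑ i ∈ Finset.Icc 1 k, (U i ω : ℕ) :=
    Finset.measurable_fun_sum _ fun i hi =>
      (measurable_of_finite fun j : State R => (j : ℕ)).comp
        (measurable_U_past (Finset.mem_Icc.1 hi).2)
  exact this measurableSet_Iio

/-- The broadcasts before the hop count update `n` nodes, up to a bounded error. -/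
theorem abs_sum_num_hopCount_sub_le (U : ℕ → Ω → State R) (n : ℕ) (ω : Ω) :
    |∑ k ∈ Finset.range (hopCount U n ω), num U k ω - n| ≤ 2 * R := by
  -- The martingale sums run over `U 0, …, U (H - 1)` and the hop count over `U 1, …, U H`. The
  -- shift and the overshoot each cost at most `R`.
  have h1 := Finset.sum_range_succ (fun k => num U k ω) (hopCount U n ω)
  have h2 := Finset.sum_range_succ' (fun k => num U k ω) (hopCount U n ω)
  have h3 : ∑ k ∈ Finset.range (hopCount U n ω), num U (k + 1) ω =
      ((∑ i ∈ Finset.Icc 1 (hopCount U n ω), (U i ω : ℕ) : ℕ) : ℝ) := by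
    rw [Finset.range_eq_Ico, Finset.sum_Ico_add' (fun k => num U k ω) 0 _ 1, Nat.cast_sum]
    rfl
  have h4 : (n : ℝ) ≤ ((∑ i ∈ Finset.Icc 1 (hopCount U n ω), (U i ω : ℕ) : ℕ) : ℝ) := by
    exact_mod_cast le_sum_hopCount U n ω
  have h5 : ((∑ i ∈ Finset.Icc 1 (hopCount U n ω), (U i ω : ℕ) : ℕ) : ℝ) ≤ n + R := by
    exact_mod_cast sum_hopCount_le U n ω
  have hb : ∀ k, 0 ≤ num U k ω ∧ num U k ω ≤ R := fun k =>
    ⟨(state_pos _).le, state_le_real _⟩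
  rw [abs_le]
  constructor <;> linarith [(hb 0).1, (hb 0).2, (hb (hopCount U n ω)).1, (hb (hopCount U n ω)).2]

theorem stronglyMeasurable_num_past {i m : ℕ} (h : i ≤ m) :
    StronglyMeasurable[past U θ m] (num U i) :=
  ((measurable_of_finite (stateVal R)).comp (measurable_U_past h)).stronglyMeasurable

variable [mΩ : MeasurableSpace Ω] {P : Measure Ω}

theorem IsProcess.memLp_num (hX : IsProcess R η P U θ) (m : ℕ) : MemLp (num U m) ⊤ P :=
  hX.memLp_comp (stateVal R) m

variable [IsProbabilityMeasure P]

/-- A form of Wald's identity: the sum of the `U`'s before the hop count is `n + O(1)`, and its mean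
is `μ_U` times the mean hop count, up to `O(1)`. -/
theorem IsProcess.tendsto_integral_hopCount_div (hX : IsProcess R η P U θ)
    (hη : η ∈ Set.Icc (0 : ℝ) 1) (hR : 1 ≤ R) :
    Tendsto (fun n : ℕ => (∫ ω, (hopCount U n ω : ℝ) ∂P) / n) atTop (𝓝 (muU R)⁻¹) := by
  have hμ := muU_pos hR
  refine tendsto_div_nat_of_abs_sub_le (b := fun n => (n : ℝ) * (muU R)⁻¹)
    (C := (2 * ∑ i, |poisson R (stateVal R) i| + 2 * R) * (muU R)⁻¹) (fun n => ?_) ?_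
  · have hτ := isBoundedStopping_hopCount U θ n
    have h1 := hX.abs_integral_occupation_sub_le hη hR hτ (stateVal R)
    rw [steady_dotProduct_stateVal] at h1
    have hint : Integrable (stopSum U θ (fun i _ _ => stateVal R i) (hopCount U n)) P :=
      integrable_of_memLp_top (hX.memLp_stopSum hη hτ fun _ _ => continuous_const)
    have h2 := norm_integral_le_of_norm_le_const (μ := P) (C := 2 * R)
      (f := fun ω => stopSum U θ (fun i _ _ => stateVal R i) (hopCount U n) ω - n)
      (ae_of_all _ fun ω => abs_sum_num_hopCount_sub_le U n ω)
    rw [integral_sub hint (integrable_const _)] at h2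
    simp only [integral_const, probReal_univ, one_smul, mul_one, Real.norm_eq_abs] at h2
    have h3 : (∫ ω, (hopCount U n ω : ℝ) ∂P) - n * (muU R)⁻¹ =
        (muU R * (∫ ω, (hopCount U n ω : ℝ) ∂P) - n) * (muU R)⁻¹ := by
      field_simp
    rw [h3, abs_mul, abs_of_pos (inv_pos.2 hμ)]
    refine mul_le_mul_of_nonneg_right ?_ (inv_pos.2 hμ).le
    rw [abs_le] at h1 h2 ⊢
    constructor <;> linarith [h1.1, h1.2, h2.1, h2.2]
  · refine tendsto_const_nhds.congr' ?_
    filter_upwards [eventually_gt_atTop 0] with n hn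
    have : (0 : ℝ) < n := by exact_mod_cast hn
    field_simp

theorem IsProcess.tendsto_variance_delay (hX : IsProcess R η P U θ)
    (hη : η ∈ Set.Icc (0 : ℝ) 1) (hR : 1 ≤ R) :
    Tendsto (fun n : ℕ => Var[delay U θ n; P] / n) atTop
      (𝓝 (asympVar R η (-(muTheta R η / muU R)) 1 * (muU R)⁻¹)) := by
  have hμ := muU_pos hR
  refine hX.tendsto_variance_additive hη hR _ 1 (isBoundedStopping_hopCount U θ)
    (hX.tendsto_integral_hopCount_div hη hR) (fun n => ?_)
    (d := fun n => muTheta R η / muU R * n) (K := |muTheta R η / muU R| * (2 * R)) fun n ω => ?_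
  · have h1 : delay U θ n = stopSum U θ (fun _ _ t => t) (hopCount U n) := by
      ext ω
      rw [delay, time, stopSum, Finset.range_eq_Ico,
        Finset.sum_Ico_add' (fun k => θ k ω) 0 (hopCount U n ω) 1]
      rfl
    rw [h1]
    exact (hX.memLp_stopSum hη (isBoundedStopping_hopCount U θ n)
      fun _ _ => continuous_id).aestronglyMeasurable
  · have h1 : delay U θ n ω - (-(muTheta R η / muU R) *
        ∑ k ∈ Finset.range (hopCount U n ω), num U k ω + 1 * time θ (hopCount U n ω) ω -
        hopCount U n ω * (-(muTheta R η / muU R) * muU R + 1 * muTheta R η)) -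
        muTheta R η / muU R * n = muTheta R η / muU R *
          (∑ k ∈ Finset.range (hopCount U n ω), num U k ω - n) := by
      -- The coefficient of `U` is chosen so that the term proportional to the random hop count
      -- disappears.
      have h2 : -(muTheta R η / muU R) * muU R + 1 * muTheta R η = 0 := by
        field_simp
        ring
      rw [h2, delay]
      ring
    rw [h1, abs_mul]
    exact mul_le_mul_of_nonneg_left (abs_sum_num_hopCount_sub_le U n ω) (abs_nonneg _)

/-! ### The stationary process -/

theorem StartsSteady.integral_comp (hs : StartsSteady P U) (hX : IsProcess R η P U θ)
    (h : State R → ℝ) : ∫ ω, h (U 0 ω) ∂P = steady R ⬝ᵥ h := by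
  have : IsProbabilityMeasure (P.map (U 0)) :=
    Measure.isProbabilityMeasure_map (hX.measurable_U 0).aemeasurable
  rw [← integral_map (f := h) (hX.measurable_U 0).aemeasurable
    (measurable_of_finite h).aestronglyMeasurable, integral_fintype Integrable.of_finite]
  refine Finset.sum_congr rfl fun i _ => ?_
  rw [map_measureReal_apply (hX.measurable_U 0) (measurableSet_singleton i), smul_eq_mul, ← hs i]
  rfl

theorem StartsSteady.covariance_comp (hs : StartsSteady P U) (hX : IsProcess R η P U θ)
    (h k : State R → ℝ) :
    cov[fun ω => h (U 0 ω), fun ω => k (U 0 ω); P] =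
      steady R ⬝ᵥ (h * k) - (steady R ⬝ᵥ h) * (steady R ⬝ᵥ k) := by
  rw [covariance_eq_sub ((hX.memLp_comp h 0).mono_exponent le_top)
    ((hX.memLp_comp k 0).mono_exponent le_top), hs.integral_comp hX, hs.integral_comp hX,
    ← hs.integral_comp hX (h * k)]
  rfl

theorem StartsSteady.covariance_num_comp_zero (hs : StartsSteady P U) (hX : IsProcess R η P U θ)
    (h : State R → ℝ) :
    cov[num U 0, fun ω => h (U 0 ω); P] =
      steady R ⬝ᵥ ((fun j : State R => ((j : ℕ) : ℝ) - muU R) * h) := by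
  have h1 := hs.covariance_comp hX (stateVal R) h
  rw [← steady_dotProduct_centered_mul, steady_dotProduct_stateVal] at h1
  exact h1

/-- Conditioning on the past replaces `h` by its image under the transition matrix, which costs a
factor `-1/2` when paired with the centred state. -/
theorem StartsSteady.covariance_num_comp (hs : StartsSteady P U) (hX : IsProcess R η P U θ)
    (hη : η ∈ Set.Icc (0 : ℝ) 1) (hR : 1 ≤ R) (j : ℕ) (h : State R → ℝ) :
    cov[num U 0, fun ω => h (U j ω); P] =
      (-(1 / 2)) ^ j * (steady R ⬝ᵥ ((fun j : State R => ((j : ℕ) : ℝ) - muU R) * h)) := by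
  induction j generalizing h with
  | zero => rw [hs.covariance_num_comp_zero hX, pow_zero, one_mul]
  | succ j ih =>
    have h1 := hX.covariance_step hη (stronglyMeasurable_num_past (Nat.zero_le j)) (hX.memLp_num 0)
      (G := fun _ j _ => h j) fun _ _ => continuous_const
    rw [stepMean_state, ih, steady_dotProduct_num_mul_mulVec hR] at h1
    rw [h1]
    ring

theorem StartsSteady.covariance_num_θ (hs : StartsSteady P U) (hX : IsProcess R η P U θ)
    (hη : η ∈ Set.Icc (0 : ℝ) 1) (hR : 1 ≤ R) (j : ℕ) :
    cov[num U 0, θ (j + 1); P] =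
      (-(1 / 2)) ^ j * (steady R ⬝ᵥ ((fun j : State R => ((j : ℕ) : ℝ) - muU R) * meanTime η)) := by
  have h1 := hX.covariance_step hη (stronglyMeasurable_num_past (Nat.zero_le j)) (hX.memLp_num 0)
    (G := fun _ _ t => t) fun _ _ => continuous_id
  rw [stepMean_time_self, hs.covariance_num_comp hX hη hR] at h1
  exact h1

theorem IsProcess.covariance_affine_num (hX : IsProcess R η P U θ) {W : Ω → ℝ} (m : ℕ) :
    cov[W, fun ω => (transMatrix R *ᵥ stateVal R) (U m ω); P] = -(1 / 2) * cov[W, num U m; P] := by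
  have h1 : (fun ω => (transMatrix R *ᵥ stateVal R) (U m ω)) =
      fun ω => (2 * (R : ℝ) + 1) / 2 + -(1 / 2) * num U m ω := by
    ext ω
    refine (transMatrix_mulVec_num (U m ω)).trans ?_
    rw [num]
    ring
  rw [h1, covariance_const_add_right ((integrable_of_memLp_top (hX.memLp_num m)).const_mul _),
    covariance_const_mul_right]

theorem StartsSteady.covariance_θ_num (hs : StartsSteady P U) (hX : IsProcess R η P U θ)
    (hη : η ∈ Set.Icc (0 : ℝ) 1) (hR : 1 ≤ R) (j : ℕ) :
    cov[θ 1, num U j; P] =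
      (-(1 / 2)) ^ j * (steady R ⬝ᵥ ((fun j : State R => ((j : ℕ) : ℝ) - muU R) * meanTime η)) := by
  have hθ := hX.memLp_θ hη 0
  induction j with
  | zero =>
    rw [covariance_comm]
    exact hs.covariance_num_θ hX hη hR 0
  | succ j ih =>
    have h1 : cov[θ 1, num U (j + 1); P] = -(1 / 2) * cov[θ 1, num U j; P] := by
      -- The variable `θ 1` is not measurable with respect to the past at time `0`, so the passage
      -- from `U 0` to `U 1` uses instead the conditional independence of `θ 1` and `U 1` given `U
      -- 0`. From time `1` on, `θ 1` belongs to the past and `covariance_step` applies.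
      rcases j with _ | j
      · have e1 := hX.integral_step hη (m := 0) (G := fun _ j t => stateVal R j * t)
          fun _ _ => by fun_prop
        have e2 := hX.integral_step hη (m := 0) (G := fun _ j _ => stateVal R j)
          fun _ _ => continuous_const
        have e3 := hX.integral_step hη (m := 0) (G := fun _ _ t => t)
          fun _ _ => continuous_id
        rw [stepMean_time] at e1
        rw [stepMean_state] at e2
        rw [stepMean_time_self] at e3
        have e4 : cov[θ 1, num U 1; P] = cov[fun ω => meanTime η (U 0 ω),
            fun ω => (transMatrix R *ᵥ stateVal R) (U 0 ω); P] := by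
          rw [covariance_eq_sub (hθ.mono_exponent le_top) ((hX.memLp_num 1).mono_exponent le_top),
            covariance_eq_sub ((hX.memLp_comp _ 0).mono_exponent le_top)
              ((hX.memLp_comp _ 0).mono_exponent le_top)]
          refine congrArg₂ _ ?_ (congrArg₂ _ e3 e2)
          rw [mul_comm]
          exact e1
        rw [e4, hX.covariance_affine_num, covariance_comm, covariance_comm (θ 1)]
        have e5 := hs.covariance_num_θ hX hη hR 0
        rw [pow_zero, one_mul, ← hs.covariance_num_comp_zero hX] at e5
        rw [← e5]
      · have e1 := hX.covariance_step hη (m := j + 1)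
          (measurable_θ_past le_rfl (by omega)).stronglyMeasurable hθ
          (G := fun _ j _ => stateVal R j) fun _ _ => continuous_const
        rw [stepMean_state, hX.covariance_affine_num] at e1
        exact e1
    rw [h1, ih]
    ring

theorem hasSum_neg_half_pow_succ (c : ℝ) :
    HasSum (fun j : ℕ => (-(1 / 2) : ℝ) ^ (j + 1) * c) (-(1 / 3) * c) := by
  have h := (hasSum_geometric_of_abs_lt_one (r := (-(1 / 2) : ℝ)) (by norm_num)).mul_left
    (-(1 / 2) * c)
  convert! h using 1
  · ext j
    ring
  · norm_num
    ring

theorem StartsSteady.hasSum_covariance_num (hs : StartsSteady P U) (hX : IsProcess R η P U θ)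
    (hη : η ∈ Set.Icc (0 : ℝ) 1) (hR : 1 ≤ R) :
    HasSum (fun j : ℕ => cov[num U 0, num U (j + 1); P])
      (-(1 / 3) * (steady R ⬝ᵥ (stateVal R * stateVal R) - muU R ^ 2)) := by
  have h2 : steady R ⬝ᵥ ((fun j : State R => ((j : ℕ) : ℝ) - muU R) * stateVal R) =
      steady R ⬝ᵥ (stateVal R * stateVal R) - muU R ^ 2 := by
    have := steady_dotProduct_centered_mul (stateVal R) (stateVal R)
    rw [steady_dotProduct_stateVal, ← sq (muU R)] at this
    exact this
  rw [← h2]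
  refine (hasSum_neg_half_pow_succ _).congr_fun fun j => ?_
  exact hs.covariance_num_comp hX hη hR (j + 1) (stateVal R)

theorem StartsSteady.gammaUSq_eq (hs : StartsSteady P U) (hX : IsProcess R η P U θ)
    (hη : η ∈ Set.Icc (0 : ℝ) 1) (hR : 1 ≤ R) :
    gammaUSq P U = 1 / 3 * (steady R ⬝ᵥ (stateVal R * stateVal R) - muU R ^ 2) := by
  have h1 : Var[num U 0; P] = steady R ⬝ᵥ (stateVal R * stateVal R) - muU R ^ 2 := by
    rw [← covariance_self (hX.memLp_num 0).aestronglyMeasurable.aemeasurable]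
    refine (hs.covariance_comp hX (stateVal R) (stateVal R)).trans ?_
    rw [steady_dotProduct_stateVal, sq]
  rw [gammaUSq, h1, (hs.hasSum_covariance_num hX hη hR).tsum_eq]
  ring

theorem timeMatrix_mulVec (x : State R → ℝ) :
    timeMatrix R η *ᵥ x = meanTime η * (transMatrix R *ᵥ x) := by
  ext i
  simp only [timeMatrix, Matrix.mulVec, dotProduct, Matrix.of_apply, Pi.mul_apply, Finset.mul_sum]
  exact Finset.sum_congr rfl fun j _ => by ring

theorem StartsSteady.gammaThetaSq_eq (hs : StartsSteady P U) (hX : IsProcess R η P U θ)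
    (hη : η ∈ Set.Icc (0 : ℝ) 1) (hR : 1 ≤ R) :
    gammaThetaSq R η P θ =
      steady R ⬝ᵥ sqTime η - 2 * (steady R ⬝ᵥ (meanTime η * meanTime η)) +
        2 * (steady R ⬝ᵥ (meanTime η * poisson R (meanTime η))) + muTheta R η ^ 2 := by
  have hvar : Var[θ 1; P] = steady R ⬝ᵥ sqTime η - muTheta R η ^ 2 := by
    have e1 := hX.integral_step hη (m := 0) (G := fun _ _ t => t ^ 2) fun _ _ => by fun_prop
    have e2 := hX.integral_step hη (m := 0) (G := fun _ _ t => t) fun _ _ => continuous_id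
    have e3 : stepMean R η (fun _ _ t => t ^ 2) = sqTime η := by
      ext i
      rw [stepMean, ← Finset.sum_mul, transMatrix_row_sum, one_mul, sqTime]
    rw [e3, hs.integral_comp hX] at e1
    rw [stepMean_time_self, hs.integral_comp hX, steady_dotProduct_meanTime] at e2
    rw [variance_eq_sub ((hX.memLp_θ hη 0).mono_exponent le_top)]
    exact congrArg₂ _ e1 (congrArg (· ^ 2) e2)
  have hmat : steady R ⬝ᵥ ((timeMatrix R η * fundamental R * timeMatrix R η) *ᵥ fun _ => 1) =
      steady R ⬝ᵥ (meanTime η * poisson R (meanTime η)) -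
        steady R ⬝ᵥ (meanTime η * meanTime η) + 2 * muTheta R η ^ 2 := by
    have h1 : timeMatrix R η *ᵥ (fun _ => 1) = meanTime η := by
      rw [timeMatrix_mulVec, transMatrix_mulVec_const]
      exact mul_one _
    -- This is `M Z M 1`, because `M 1` is `meanTime η` and `Z` sends it to its Poisson solution
    -- plus its mean. The Poisson equation then removes the transition matrix.
    have h2 : meanTime η * (transMatrix R *ᵥ fun i => poisson R (meanTime η) i + muTheta R η) =
        meanTime η * poisson R (meanTime η) - meanTime η * meanTime η +
          (2 * muTheta R η) • meanTime η := by
      have e : (fun i => poisson R (meanTime η) i + muTheta R η) =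
        poisson R (meanTime η) + fun _ => muTheta R η := rfl
      ext i
      have := poisson_sub_mulVec hR (meanTime η) i
      rw [steady_dotProduct_meanTime] at this
      rw [e, Matrix.mulVec_add, transMatrix_mulVec_const]
      simp only [Pi.mul_apply, Pi.add_apply, Pi.sub_apply, Pi.smul_apply, smul_eq_mul]
      linear_combination -meanTime η i * this
    rw [← Matrix.mulVec_mulVec, ← Matrix.mulVec_mulVec, h1, fundamental_mulVec hR, timeMatrix_mulVec,
      steady_dotProduct_meanTime, h2, dotProduct_add, dotProduct_sub, dotProduct_smul,
      steady_dotProduct_meanTime, smul_eq_mul]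
    ring
  rw [gammaThetaSq, hvar, hmat]
  ring

/-- The left side involves no probability space. This lets constants computed for the stationary
process describe limits for any initial law. -/
theorem asympVar_eq_gamma (hη : η ∈ Set.Icc (0 : ℝ) 1) (hR : 1 ≤ R) (hs : StartsSteady P U)
    (hX : IsProcess R η P U θ) (a b : ℝ) :
    asympVar R η a b = a ^ 2 * gammaUSq P U + b ^ 2 * gammaThetaSq R η P θ +
      2 * a * b * Delta R η := by
  rw [asympVar_eq hη hR, hs.gammaUSq_eq hX hη hR, hs.gammaThetaSq_eq hX hη hR]

end

end Trickle

end

/-! ### Assembly of the limits and constants. -/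

theorem theorem2 (R : ℕ) (hR : 1 ≤ R) (η : ℝ) (hη : η ∈ Set.Icc (0 : ℝ) 1)
    -- the process, with an arbitrary initial distribution
    {Ω : Type*} [MeasurableSpace Ω] (P : Measure Ω) [IsProbabilityMeasure P]
    (U : ℕ → Ω → Trickle.State R) (θ : ℕ → Ω → ℝ) (hX : Trickle.IsProcess R η P U θ)
    -- the stationary process, in terms of which the constants are expressed
    {Ω' : Type*} [MeasurableSpace Ω'] (P' : Measure Ω') [IsProbabilityMeasure P']
    (U' : ℕ → Ω' → Trickle.State R) (θ' : ℕ → Ω' → ℝ) (hX' : Trickle.IsProcess R η P' U' θ')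
    (hstat : Trickle.StartsSteady P' U') :
    -- the two expressions for `γ_U²`
    (Summable (fun j : ℕ => cov[Trickle.num U' 0, Trickle.num U' (j + 1); P']) ∧
      Tendsto (fun m : ℕ =>
          Var[fun ω => ∑ i ∈ Finset.range (m + 1), Trickle.num U i ω; P] / (m : ℝ))
        atTop (𝓝 (Trickle.gammaUSq P' U'))) ∧
    -- the fundamental matrix exists, and the expression for `γ_θ²`
    (IsUnit (Trickle.fundamentalInv R) ∧
      Tendsto (fun m : ℕ => Var[Trickle.time θ (m + 1); P] / (m : ℝ))
        atTop (𝓝 (Trickle.gammaThetaSq R η P' θ'))) ∧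
    -- the explicit formula for `Δ`
    (Summable (fun j : ℕ => cov[Trickle.num U' 0, θ' (j + 2); P']) ∧
      Summable (fun j : ℕ => cov[θ' 1, Trickle.num U' (j + 1); P']) ∧
      cov[θ' 1, Trickle.num U' 0; P']
        + ∑' j : ℕ, cov[Trickle.num U' 0, θ' (j + 2); P']
        + ∑' j : ℕ, cov[θ' 1, Trickle.num U' (j + 1); P'] = Trickle.Delta R η) ∧
    -- `γ_T²`, and the asymptotics of the variance of the end-to-end delay
    ∃ γTSq : ℝ,
      Tendsto (fun m : ℕ =>
          Var[fun ω => (∑ i ∈ Finset.range (m + 1), Trickle.num U i ω) * Trickle.muTheta R η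
            - Trickle.time θ (m + 1) ω * Trickle.muU R; P] / (m : ℝ))
        atTop (𝓝 γTSq) ∧
      Tendsto (fun n : ℕ => Var[Trickle.delay U θ n; P] / (n : ℝ))
        atTop (𝓝 (γTSq / Trickle.muU R ^ 3)) ∧
      γTSq / Trickle.muU R ^ 3 =
        (Trickle.muTheta R η ^ 2 * Trickle.gammaUSq P' U'
          + Trickle.muU R ^ 2 * Trickle.gammaThetaSq R η P' θ'
          - 2 * Trickle.muU R * Trickle.muTheta R η * Trickle.Delta R η) / Trickle.muU R ^ 3 := by

  have hμ := Trickle.muU_pos hR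
  have hq := Trickle.asympVar_eq_gamma hη hR hstat hX'
  have hθnum := hstat.covariance_θ_num hX' hη hR
  have hnumθ := hstat.covariance_num_θ hX' hη hR
  have hsum := Trickle.hasSum_neg_half_pow_succ
    (Trickle.steady R ⬝ᵥ ((fun j : Trickle.State R => ((j : ℕ) : ℝ) - Trickle.muU R) *
      Trickle.meanTime η))
  have hsum1 : HasSum (fun j : ℕ => cov[Trickle.num U' 0, θ' (j + 2); P']) _ :=
    hsum.congr_fun fun j => hnumθ (j + 1)
  have hsum2 : HasSum (fun j : ℕ => cov[θ' 1, Trickle.num U' (j + 1); P']) _ :=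
    hsum.congr_fun fun j => hθnum (j + 1)
  refine ⟨⟨(hstat.hasSum_covariance_num hX' hη hR).summable, ?_⟩,
    ⟨Trickle.isUnit_fundamentalInv hR, ?_⟩, ⟨hsum1.summable, hsum2.summable, ?_⟩,
    Trickle.asympVar R η (Trickle.muTheta R η) (-Trickle.muU R), ?_, ?_, ?_⟩
  · have h := hX.tendsto_variance_linear hη hR 1 0
    rw [hq] at h
    simpa using h
  · have h := hX.tendsto_variance_linear hη hR 0 1
    rw [hq] at h
    simpa using h
  -- The lag-zero covariance and the two geometric tails combine to the factor `1 - 1/3 - 1/3 = 1/3`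
  -- of `Delta_eq`.
  · rw [hsum1.tsum_eq, hsum2.tsum_eq, hθnum 0, Trickle.Delta_eq hR]
    ring
  · refine (hX.tendsto_variance_linear hη hR (Trickle.muTheta R η) (-Trickle.muU R)).congr
      fun m => ?_
    congr 2
    ext ω
    ring
  -- The coefficients `(-μ_θ / μ_U, 1)` are `-1 / μ_U` times `(μ_θ, -μ_U)`. Homogeneity of degree
  -- two gives `μ_U ^ 2` in the denominator, and the growth rate of the hop count gives the third
  -- factor.
  · have h := hX.tendsto_variance_delay hη hR
    convert! h using 2
    rw [hq, hq]
    field_simp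
  · rw [hq]
    ring
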